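/- Fix $T,\chi,\kappa>0$. Let $\{Y_t;\,t\in[0,T]\}$ be a (measurable) $\mathcal S'(\mathbb R)$-valued stochastic process on a probability space, let $\nabla u=u'$, $\langle u,v\rangle=\int_{\mathbb R}uv\,dx$, and $\mathcal E(u)=\langle\nabla u,\nabla u\rangle$ for $u\in\mathcal S(\mathbb R)$. Assume: **(S)** for every $t\in[0,T]$, $Y_t$ is a white noise of variance $\chi$, that is, $Y_t(u)$ is Gaussian with mean $0$ and variance $\chi\langle u,u\rangle$ for every $u\in\mathcal S(\mathbb R)$. By (S), $Y_t(f)$ is well defined almost surely for every $f\in L^2(\mathbb R)$, as the limit in $L^2$ of $Y_t(u)$ as $u\in\mathcal S(\mathbb R)$ tends to $f$ in $L^2(\mathbb R)$. For $\epsilon>0$, $x\in\mathbb R$ let $i_\epsilon(x)$ be the function $y\mapsto\epsilon^{-1}\mathbf 1_{x<y\le x+\epsilon}$, and put $$A^\epsilon_{s,t}(u)=\int_s^t\int_{\mathbb R}Y_r(i_\epsilon(x))^2\,\nabla u(x)\,dx\,dr .$$ Assume also: **(EC2)** for every $u\in\mathcal S(\mathbb R)$, all $0<\delta<\epsilon<1$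 and all $s<t$ in $[0,T]$, $$\mathbb E\big[(A^\epsilon_{s,t}(u)-A^\delta_{s,t}(u))^2\big]\le\kappa\,(t-s)\,\epsilon\,\mathcal E(u).$$ Then condition **(NL)** holds: there is an $\mathcal S'(\mathbb R)$-valued process $\{A_t;\,t\in[0,T]\}$ with continuous paths (for the strong topology of $\mathcal S'(\mathbb R)$) such that, for every $t\in[0,T]$ and $u\in\mathcal S(\mathbb R)$, the random variables $A^\epsilon_{0,t}(u)$ converge to $A_t(u)$ in $L^2$ as $\epsilon\to0$. Moreover, there is a constant $K>0$ that depends only on $T,\chi,\kappa$ such that $\mathbb E[A_t(u)^2]\le K\,t^{3/2}\,\mathcal E(u)$ for all $t\in[0,T]$ and $u\in\mathcal S(\mathbb R)$. -/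

import Mathlib

open MeasureTheory ProbabilityTheory Filter Topology
open scoped SchwartzMap ENNReal

noncomputable section

namespace SBE

/-- The space `S'(ℝ)` of real tempered distributions: the continuous linear functionals on the real
Schwartz space. The topology that this type carries is that of uniform convergence on bounded
subsets of `S(ℝ)`, i.e. the strong topology. -/
abbrev TemperedDist : Type := 𝓢(ℝ, ℝ) →L[ℝ] ℝ

/-- The energy `⟨∇u, ∇u⟩` of a test function. -/
def energy (u : 𝓢(ℝ, ℝ)) : ℝ := ∫ x, (deriv u x) ^ 2

/-- The function `y ↦ ε⁻¹ 1_{x < y ≤ x + ε}`. -/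
def boxFn (ε x : ℝ) : ℝ → ℝ := (Set.Ioc x (x + ε)).indicator fun _ => ε⁻¹

variable {Ω : Type*} [MeasurableSpace Ω]

/-- The second moment `E[X²]`, as an element of `[0, ∞]`. -/
def meanSq (P : Measure Ω) (X : Ω → ℝ) : ℝ≥0∞ := ∫⁻ ω, ‖X ω‖ₑ ^ 2 ∂P

/-- `W` is a white noise of mean zero and variance `χ`: for every test function `u` the random
variable `W(u)` is Gaussian of mean zero and variance `χ ⟨u, u⟩`. -/
def IsWhiteNoise (P : Measure Ω) (χ : ℝ) (W : Ω → TemperedDist) : Prop :=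
  ∀ u : 𝓢(ℝ, ℝ),
    HasLaw (fun ω => W ω u) (gaussianReal 0 (χ * ∫ x, (u x) ^ 2).toNNReal) P

open Classical in
/-- The class in `L²(P)` of a random variable (zero if it is not square integrable). -/
def classL2 (P : Measure Ω) (X : Ω → ℝ) : Lp ℝ 2 P :=
  if h : MemLp X 2 P then h.toLp X else 0

/-- The random variable `W(f)`, for a function `f` in `L²(ℝ)` that need not be a test function: the
limit in `L²(P)` of `W(u)` as the test function `u` tends to `f` in `L²(ℝ)`. If `W` is a white
noise, the limit exists, since then `E[(W(u) - W(v))²] = χ ⟨u - v, u - v⟩`. -/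
def evalL2 (P : Measure Ω) (W : Ω → TemperedDist) (f : ℝ → ℝ) : Lp ℝ 2 P :=
  limUnder (comap (fun u : 𝓢(ℝ, ℝ) => eLpNorm (fun y => u y - f y) 2 volume) (𝓝 0))
    (fun u : 𝓢(ℝ, ℝ) => classL2 P (fun ω => W ω u))

/-- The square of an element of `L²(P)`, as an element of `L¹(P)`. -/
def sqL1 {P : Measure Ω} (X : Lp ℝ 2 P) : Lp ℝ 1 P :=
  (Lp.memLp X).integrable_sq.toL1 (fun ω => X ω ^ 2)

/-- The regularized quadratic term
`A^ε_{s,t}(u) = ∫_s^t ∫_ℝ Y_r(i_ε(x))² ∇u(x) dx dr`, where `i_ε(x)` is `boxFn ε x`. Each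
`Y_r(i_ε(x))` is defined up to a null set only, so this is the (Bochner) integral of a family of
random variables in `L¹(P)`; it is the class of the pathwise integral of any version of
`Y_r(i_ε(x))` that is jointly measurable in `r`, `x` and the random parameter. -/
def quadTerm (P : Measure Ω) (Y : ℝ → Ω → TemperedDist) (ε s t : ℝ) (u : 𝓢(ℝ, ℝ)) :
    Lp ℝ 1 P :=
  ∫ r in s..t, ∫ x, deriv u x • sqL1 (evalL2 P (Y r) (boxFn ε x))

/-- `{Y_t ; t ∈ [0, T]}` is a measurable process: each `Y_t(u)` is jointly measurable in the time
`t ∈ [0, T]` and the random parameter (up to null sets). This holds for a process with continuous,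
or càdlàg, paths. -/
def IsMeasurableProcess (P : Measure Ω) (T : ℝ) (Y : ℝ → Ω → TemperedDist) : Prop :=
  ∀ u : 𝓢(ℝ, ℝ), AEMeasurable (fun p : ℝ × Ω => Y p.1 p.2 u)
    ((volume.restrict (Set.Icc 0 T)).prod P)

/-- Stationarity, condition (S). -/
def ConditionS (P : Measure Ω) (T χ : ℝ) (Y : ℝ → Ω → TemperedDist) : Prop :=
  ∀ t ∈ Set.Icc 0 T, IsWhiteNoise P χ (Y t)

/-- The energy estimate, condition (EC2), with constant `κ`. -/
def ConditionEC2 (P : Measure Ω) (T κ : ℝ) (Y : ℝ → Ω → TemperedDist) : Prop :=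
  ∀ (u : 𝓢(ℝ, ℝ)) (δ ε : ℝ), 0 < δ → δ < ε → ε < 1 →
    ∀ s ∈ Set.Icc 0 T, ∀ t ∈ Set.Icc 0 T, s < t →
      meanSq P (fun ω => quadTerm P Y ε s t u ω - quadTerm P Y δ s t u ω) ≤
        ENNReal.ofReal (κ * (t - s) * ε * energy u)

/-- `{A_t ; t ∈ [0, T]}` is an `S'(ℝ)`-valued process with continuous paths, for the strong topology
of `S'(ℝ)`, and `A_t(u)` is the limit in `L²` of `A^ε_{0,t}(u)` as `ε` tends to zero, for all
`t ∈ [0, T]` and all test functions `u`. -/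
structure IsQuadraticProcess (P : Measure Ω) (T : ℝ) (Y A : ℝ → Ω → TemperedDist) : Prop where
  measurable : ∀ t ∈ Set.Icc 0 T, ∀ u : 𝓢(ℝ, ℝ), Measurable fun ω => A t ω u
  continuous_paths : ∀ ω, ContinuousOn (fun t => A t ω) (Set.Icc 0 T)
  memLp : ∀ t ∈ Set.Icc 0 T, ∀ u : 𝓢(ℝ, ℝ), MemLp (fun ω => A t ω u) 2 P
  memLp_quadTerm : ∀ t ∈ Set.Icc 0 T, ∀ u : 𝓢(ℝ, ℝ), ∀ ε > 0, MemLp (quadTerm P Y ε 0 t u) 2 P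
  tendsto : ∀ t ∈ Set.Icc 0 T, ∀ u : 𝓢(ℝ, ℝ),
    Tendsto (fun ε : ℝ => meanSq P fun ω => quadTerm P Y ε 0 t u ω - A t ω u) (𝓝[>] 0) (𝓝 0)

/-- Condition (NL). -/
def ConditionNL (P : Measure Ω) (T : ℝ) (Y : ℝ → Ω → TemperedDist) : Prop :=
  ∃ A : ℝ → Ω → TemperedDist, IsQuadraticProcess P T Y A

end SBE

end

noncomputable section

namespace SBE

/-! Since `∇u` has integral zero, `Y_r(i_ε(x))²` may be replaced by the Wick square `Y_r(i_ε(x))² -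
χ/ε` (`IsWhiteNoise.integral_sqL1`). Wick squares lie in `L²(P)`, and Isserlis' formula gives them
the covariance `2χ²⟨f, g⟩²` (`IsWhiteNoise.inner_wickSq`). The kernel `⟨i_ε(x), i_ε(y)⟩²` is at most
`ε⁻²` and vanishes for `|x - y| > ε`, so Schur's test bounds the second moment of the spatial
integral by `4χ²ε⁻¹ℰ(u)`. Integrating the norm in time, `E[A^ε_{s,t}(u)²] ≤ 4χ²(t - s)²ε⁻¹ℰ(u)`.

(EC2) makes `A^ε_{0,t}(u)` Cauchy in `L²(P)` as `ε → 0`. It also bounds the distance from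
`A^ε_{s,t}(u)` to the limit by a multiple of `(t - s)ε ℰ(u)`. Taking `ε` of order `√(t - s)`
balances the two bounds and gives increments with second moment at most `C(t - s)^{3/2}ℰ(u)`
(`norm_sq_sub_le_of_tendsto`). With `s = 0` this is the final estimate.

The exponent `3/2` exceeds `1`, so Kolmogorov's theorem gives, for each `u`, a continuous path in
`L²(P; C[0, T])` of norm at most a constant times `‖∇u‖` (`exists_continuous_version`). The path
therefore depends on `u` through a continuous linear map `L` of `∇u ∈ L²(ℝ)` (`exists_clm_paths`).

It remains to find one exceptional null set for all `u`. Let `e_z(x) = 1_{z<x} e^{z-x}`. For a test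
function `v`, `v = ∫ (v + ∇v)(z) e_z dz`. With `v = ∇u`, the coefficient is the `L²(ℝ)` pairing of
`(1 + z²)⁻¹ e_z` with `Du`, where `D = (1 - ∇)(1 + x²)(1 + ∇)∇`. Hence `L(∇u) = ⟨V, Du⟩`, where `V =
∫ L(e_z) ⊗ (1 + z²)⁻¹ e_z dz` converges absolutely in `L²(P; C([0, T], L²(ℝ)))`. Then `A_t(u) =
⟨V_t, Du⟩` is a tempered distribution for every `ω`, strongly continuous in `t`. This explicit
factorization plays the role of nuclearity. -/

/-- A linear map that is bounded by the seminorm `‖D v‖`, for a linear map `D` into a Hilbert space,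
factors through a continuous linear map on that Hilbert space. -/
theorem exists_clm_comp_eq {V H X : Type*} [AddCommGroup V] [Module ℝ V] [NormedAddCommGroup H]
    [InnerProductSpace ℝ H] [CompleteSpace H] [NormedAddCommGroup X] [NormedSpace ℝ X]
    [CompleteSpace X] (D : V →ₗ[ℝ] H) (l : V →ₗ[ℝ] X) (C : ℝ) (h : ∀ v, ‖l v‖ ≤ C * ‖D v‖) :
    ∃ L : H →L[ℝ] X, ∀ v, L (D v) = l v := by
  set S : Submodule ℝ H := (LinearMap.range D).topologicalClosure with hS
  have hmem : ∀ v, D v ∈ S := fun v =>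
    Submodule.le_topologicalClosure _ (LinearMap.mem_range_self D v)
  let e : V →ₗ[ℝ] S := D.codRestrict S hmem
  have hd : DenseRange e := by
    rw [DenseRange, Subtype.dense_iff]
    intro x hx
    have : (Subtype.val '' Set.range e) = (LinearMap.range D : Set H) := by
      ext y
      simp [e, Set.range, LinearMap.codRestrict_apply]
    have hx' : x ∈ closure (LinearMap.range D : Set H) := hx
    rw [← this] at hx'
    exact hx'
  have : CompleteSpace S := (Submodule.isClosed_topologicalClosure _).completeSpace_coe
  -- The range of `D` need not be dense in `H`. The extension lives on its closure, and the
  -- orthogonal projection carries it to all of `H`.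
  refine ⟨(l.extendOfNorm e).comp S.orthogonalProjectionOnto, fun v => ?_⟩
  have hp : S.orthogonalProjectionOnto (D v) = e v :=
    Submodule.orthogonalProjectionOnto_mem_subspace_eq_self (K := S) ⟨D v, hmem v⟩
  rw [ContinuousLinearMap.comp_apply, hp]
  exact LinearMap.extendOfNorm_eq hd ⟨C, fun x => h x⟩ v

/-! ### Random variables as elements of `L²(P)`; strong measurability in time. -/

section ClassL2

variable {Ω : Type*} [MeasurableSpace Ω] {P : Measure Ω} {X Z : Ω → ℝ}

theorem classL2_of_memLp (h : MemLp X 2 P) : classL2 P X = h.toLp X := dif_pos h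

theorem coeFn_classL2 (h : MemLp X 2 P) : classL2 P X =ᵐ[P] X := by
  rw [classL2_of_memLp h]; exact h.coeFn_toLp

theorem classL2_congr (h : X =ᵐ[P] Z) : classL2 P X = classL2 P Z := by
  by_cases hX : MemLp X 2 P
  · rw [classL2_of_memLp hX, classL2_of_memLp (hX.ae_eq h)]
    exact (MemLp.toLp_eq_toLp_iff _ _).2 h
  · have hZ : ¬ MemLp Z 2 P := fun hZ => hX (hZ.ae_eq h.symm)
    simp [classL2, hX, hZ]

theorem classL2_add (hX : MemLp X 2 P) (hZ : MemLp Z 2 P) :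
    classL2 P (fun ω => X ω + Z ω) = classL2 P X + classL2 P Z := by
  rw [classL2_of_memLp hX, classL2_of_memLp hZ, ← MemLp.toLp_add hX hZ]
  exact classL2_of_memLp (hX.add hZ)

theorem classL2_smul (hX : MemLp X 2 P) (c : ℝ) :
    classL2 P (fun ω => c * X ω) = c • classL2 P X := by
  rw [classL2_of_memLp hX, ← MemLp.toLp_const_smul c hX]
  exact classL2_of_memLp (hX.const_smul c)

theorem inner_classL2 (hX : MemLp X 2 P) (hZ : MemLp Z 2 P) :
    inner ℝ (classL2 P X) (classL2 P Z) = ∫ ω, X ω * Z ω ∂P := by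
  rw [L2.inner_def]
  refine integral_congr_ae ?_
  filter_upwards [coeFn_classL2 hX, coeFn_classL2 hZ] with ω h1 h2
  rw [h1, h2]
  simp [mul_comm]

theorem norm_sq_classL2 (hX : MemLp X 2 P) : ‖classL2 P X‖ ^ 2 = ∫ ω, X ω ^ 2 ∂P := by
  rw [← real_inner_self_eq_norm_sq, inner_classL2 hX hX]
  simp [sq]

theorem classL2_coe (f : Lp ℝ 2 P) : classL2 P f = f := by
  rw [classL2_of_memLp (Lp.memLp f), Lp.toLp_coeFn]

theorem meanSq_eq (f : Lp ℝ 2 P) : meanSq P f = ENNReal.ofReal (‖f‖ ^ 2) := by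
  rw [Lp.norm_def, ← ENNReal.toReal_pow, ENNReal.ofReal_toReal
    (ENNReal.pow_ne_top (Lp.eLpNorm_ne_top f)),
    eLpNorm_eq_lintegral_rpow_enorm_toReal two_ne_zero ENNReal.ofNat_ne_top, ← ENNReal.rpow_natCast,
    ← ENNReal.rpow_mul]
  simp [meanSq]

theorem meanSq_congr (h : X =ᵐ[P] Z) : meanSq P X = meanSq P Z := by
  refine lintegral_congr_ae ?_
  filter_upwards [h] with ω hω
  rw [hω]

variable {α : Type*} [MeasurableSpace α] [IsFiniteMeasure P]

/-- `L²(P)` need not be separable, so strong measurability cannot be read off from measurability.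
Dynkin's π-λ argument supplies it: rectangles give constants cut off to a measurable set of times,
complements give differences, and disjoint unions give `L²` limits of partial sums. -/
theorem stronglyMeasurable_indicatorConstLp_section {E : Set (α × Ω)} (hE : MeasurableSet E) :
    StronglyMeasurable fun r =>
      indicatorConstLp 2 (measurable_prodMk_left (x := r) hE) (measure_ne_top P _) (1 : ℝ) := by
  induction E, hE using MeasurableSpace.induction_on_inter generateFrom_prod.symm
    isPiSystem_prod with
  | empty =>
    have : (fun r : α => indicatorConstLp 2 (measurable_prodMk_left (x := r)
        (MeasurableSet.empty : MeasurableSet (∅ : Set (α × Ω)))) (measure_ne_top P _) (1 : ℝ))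
        = fun _ => 0 := by
      funext r
      simp
    rw [this]
    exact stronglyMeasurable_const
  | basic E hE =>
    obtain ⟨s, hs, t, ht, rfl⟩ := hE
    have : (fun r : α => indicatorConstLp 2 (measurable_prodMk_left (x := r)
        (MeasurableSet.prod hs ht)) (measure_ne_top P _) (1 : ℝ))
        = s.indicator fun _ => indicatorConstLp 2 ht (measure_ne_top P t) (1 : ℝ) := by
      funext r
      by_cases hr : r ∈ s <;> simp [hr]
    convert! stronglyMeasurable_const.indicator hs
  | compl E hE ih =>
    have : ∀ r : α, indicatorConstLp 2 (measurable_prodMk_left (x := r) hE.compl)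
        (measure_ne_top P _) (1 : ℝ) = indicatorConstLp 2 MeasurableSet.univ (measure_ne_top P _)
          (1 : ℝ) - indicatorConstLp 2 (measurable_prodMk_left (x := r) hE)
            (measure_ne_top P _) (1 : ℝ) := by
      intro r
      rw [eq_sub_iff_add_eq, add_comm, ← indicatorConstLp_disjoint_union]
      · congr 1
        ext; simp
      · exact disjoint_compl_right
    simp_rw [this]
    exact stronglyMeasurable_const.sub ih
  | iUnion f hd hf ih =>
    have hm : ∀ n : ℕ, MeasurableSet (⋃ i ∈ Finset.range n, f i) := fun n =>
      Finset.measurableSet_biUnion _ fun i _ => hf i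
    have h1 : ∀ n : ℕ, StronglyMeasurable fun r : α => indicatorConstLp 2
        (measurable_prodMk_left (x := r) (hm n)) (measure_ne_top P _) (1 : ℝ) := by
      intro n
      induction n with
      | zero =>
        convert! (stronglyMeasurable_const : StronglyMeasurable fun _ : α => (0 : Lp ℝ 2 P))
          using 2
        simp
      | succ n ihn =>
        have : ∀ r : α, indicatorConstLp 2 (measurable_prodMk_left (x := r) (hm (n + 1)))
            (measure_ne_top P _) (1 : ℝ) = indicatorConstLp 2 (measurable_prodMk_left (x := r)
              (hm n)) (measure_ne_top P _) (1 : ℝ) + indicatorConstLp 2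
              (measurable_prodMk_left (x := r) (hf n)) (measure_ne_top P _) (1 : ℝ) := by
          intro r
          rw [← indicatorConstLp_disjoint_union]
          · congr 1
            ext ω
            simp [Finset.range_add_one, or_comm]
          · refine Disjoint.preimage _ ?_
            simp only [Set.disjoint_iUnion_left]
            intro i hi
            exact hd (by simp at hi; omega)
        simp_rw [this]
        exact ihn.add (ih n)
    refine stronglyMeasurable_of_tendsto atTop h1 (tendsto_pi_nhds.2 fun r => ?_)
    refine tendsto_indicatorConstLp_set (by simp) ?_
    have hU : Prod.mk r ⁻¹' (⋃ i, f i) = ⋃ n, Prod.mk r ⁻¹' (⋃ i ∈ Finset.range n, f i) := by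
      ext ω
      simp only [Set.mem_preimage, Set.mem_iUnion, Finset.mem_range, exists_prop]
      exact ⟨fun ⟨i, hi⟩ => ⟨i + 1, i, by omega, hi⟩, fun ⟨_, i, _, hi⟩ => ⟨i, hi⟩⟩
    have hmono : Monotone fun n : ℕ => Prod.mk r ⁻¹' (⋃ i ∈ Finset.range n, f i) := by
      intro m n hmn
      refine Set.preimage_mono (Set.biUnion_subset_biUnion_left ?_)
      exact fun i hi => by simp at hi ⊢; omega
    have ht := tendsto_measure_iUnion_atTop (μ := P) hmono
    rw [← hU] at ht
    have hs : ∀ n : ℕ, P (symmDiff (Prod.mk r ⁻¹' (⋃ i ∈ Finset.range n, f i))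
        (Prod.mk r ⁻¹' (⋃ i, f i)))
        = P (Prod.mk r ⁻¹' (⋃ i, f i)) - P (Prod.mk r ⁻¹' (⋃ i ∈ Finset.range n, f i)) := by
      intro n
      have hsub : Prod.mk r ⁻¹' (⋃ i ∈ Finset.range n, f i) ⊆ Prod.mk r ⁻¹' (⋃ i, f i) := by
        rw [hU]; exact Set.subset_iUnion (fun n : ℕ => Prod.mk r ⁻¹' (⋃ i ∈ Finset.range n, f i)) n
      rw [symmDiff_of_le hsub]
      exact measure_sdiff hsub (measurable_prodMk_left (hm n)).nullMeasurableSet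
        (measure_ne_top P _)
    simp_rw [hs]
    have h2 := ENNReal.Tendsto.sub (tendsto_const_nhds (x := P (Prod.mk r ⁻¹' (⋃ i, f i)))) ht
      (Or.inl (measure_ne_top P _))
    simpa using h2

theorem memLp_simpleFunc_section (φ : SimpleFunc (α × Ω) ℝ) (r : α) :
    MemLp (fun ω => φ (r, ω)) 2 P := by
  obtain ⟨C, hC⟩ := φ.exists_forall_norm_le
  exact MemLp.of_bound (φ.measurable.comp measurable_prodMk_left).aestronglyMeasurable C
    (ae_of_all _ fun ω => hC _)

theorem stronglyMeasurable_classL2_simpleFunc (φ : SimpleFunc (α × Ω) ℝ) :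
    StronglyMeasurable fun r => classL2 P fun ω => φ (r, ω) := by
  induction φ using SimpleFunc.induction with
  | @const c s hs =>
    convert! (stronglyMeasurable_indicatorConstLp_section (P := P) hs).const_smul c using 2 with r
    rw [Pi.smul_apply, indicatorConstLp, ← MemLp.toLp_const_smul, ← classL2_of_memLp]
    refine classL2_congr (ae_of_all _ fun ω => ?_)
    by_cases h : (r, ω) ∈ s <;> simp [h]
  | @add f g _ hf hg =>
    convert! hf.add hg using 2 with r
    exact classL2_add (memLp_simpleFunc_section f r) (memLp_simpleFunc_section g r)

/-- A jointly measurable process is strongly measurable as a function of the time with values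
in `L²(P)`. -/
theorem stronglyMeasurable_classL2 {f : α × Ω → ℝ} (hf : Measurable f) :
    StronglyMeasurable fun r => classL2 P fun ω => f (r, ω) := by
  classical
  have hm : ∀ r, AEStronglyMeasurable (fun ω => f (r, ω)) P := fun r =>
    (hf.comp measurable_prodMk_left).aestronglyMeasurable
  set S : Set α := {r | ∫⁻ ω, ‖f (r, ω)‖ₑ ^ 2 ∂P < ∞} with hS
  have hSm : MeasurableSet S :=
    measurableSet_lt (Measurable.lintegral_prod_right' (f := fun p => ‖f p‖ₑ ^ 2)
      (hf.enorm.pow_const 2)) measurable_const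
  have hSL : ∀ r, r ∈ S ↔ MemLp (fun ω => f (r, ω)) 2 P := by
    intro r
    rw [MemLp, and_iff_right (hm r),
      eLpNorm_lt_top_iff_lintegral_rpow_enorm_lt_top two_ne_zero ENNReal.ofNat_ne_top]
    simp [hS]
  let φ : ℕ → SimpleFunc (α × Ω) ℝ := fun n =>
    SimpleFunc.approxOn f hf Set.univ 0 (Set.mem_univ _) n
  -- Times outside `S`, where the section is not square integrable, have the default class zero, so
  -- the approximations are cut off there.
  refine stronglyMeasurable_of_tendsto atTop
    (f := fun n r => S.indicator (fun r => classL2 P fun ω => φ n (r, ω)) r)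
    (fun n => (stronglyMeasurable_classL2_simpleFunc (φ n)).indicator hSm)
    (tendsto_pi_nhds.2 fun r => ?_)
  by_cases hr : r ∈ S
  · simp only [Set.indicator_of_mem hr]
    have hL := (hSL r).1 hr
    rw [classL2_of_memLp hL]
    simp_rw [classL2_of_memLp (memLp_simpleFunc_section (φ _) r)]
    rw [Lp.tendsto_Lp_iff_tendsto_eLpNorm'']
    have := SimpleFunc.tendsto_approxOn_Lp_eLpNorm (p := 2) (μ := P)
      (hf.comp (measurable_prodMk_left (x := r)))
      (Set.mem_univ (0 : ℝ)) ENNReal.ofNat_ne_top (by simp) (by simpa using! hL.2)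
    exact this
  · simp only [Set.indicator_of_notMem hr]
    rw [classL2, dif_neg (fun h => hr ((hSL r).2 h))]
    exact tendsto_const_nhds

theorem aestronglyMeasurable_classL2 {μ : Measure α} [SFinite μ] {f : α × Ω → ℝ}
    (hf : AEMeasurable f (μ.prod P)) :
    AEStronglyMeasurable (fun r => classL2 P fun ω => f (r, ω)) μ := by
  refine ⟨_, stronglyMeasurable_classL2 (P := P) hf.measurable_mk, ?_⟩
  filter_upwards [Measure.ae_ae_of_ae_prod hf.ae_eq_mk] with r hr
  exact classL2_congr hr

end ClassL2

/-- A Carathéodory function is jointly almost everywhere strongly measurable. -/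
theorem aestronglyMeasurable_uncurry_of_continuous {α ι β : Type*} [MeasurableSpace α]
    [TopologicalSpace ι] [TopologicalSpace.MetrizableSpace ι] [MeasurableSpace ι]
    [SecondCountableTopology ι] [OpensMeasurableSpace ι] [NormedAddCommGroup β]
    {μ : Measure α} {ν : Measure ι} [SFinite μ] [SFinite ν] {u : α → ι → β}
    (hc : ∀ᵐ a ∂μ, Continuous (u a)) (hm : ∀ i, AEStronglyMeasurable (fun a => u a i) μ) :
    AEStronglyMeasurable (Function.uncurry u) (μ.prod ν) := by
  classical
  obtain ⟨D, hD, hDd⟩ := TopologicalSpace.exists_countable_dense ι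
  -- By continuity in `i` a countable dense set of indices is enough, so one null set carries all
  -- the exceptions.
  have hall : ∀ᵐ a ∂μ, Continuous (u a) ∧ ∀ i ∈ D, u a i = (hm i).mk _ a :=
    hc.and ((ae_ball_iff hD).2 fun i _ => (hm i).ae_eq_mk)
  obtain ⟨N, hN, hNm, hN0⟩ := exists_measurable_superset_of_null (ae_iff.1 hall)
  set G := Nᶜ
  have hGm : MeasurableSet G := hNm.compl
  have hG : ∀ a ∈ G, Continuous (u a) ∧ ∀ i ∈ D, u a i = (hm i).mk _ a := fun a ha => by
    by_contra h
    exact ha (hN h)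
  have hGu : ∀ᵐ a ∂μ, a ∈ G := compl_mem_ae_iff.2 hN0
  let v : ι → α → β := fun i => G.indicator fun a => u a i
  have hvD : ∀ i ∈ D, StronglyMeasurable (v i) := by
    intro i hi
    have : v i = G.indicator ((hm i).mk _) := by
      funext a
      by_cases ha : a ∈ G
      · simp only [v, Set.indicator_of_mem ha]
        exact (hG a ha).2 i hi
      · simp [v, ha]
    rw [this]
    exact (hm i).stronglyMeasurable_mk.indicator hGm
  have hvc : ∀ a, Continuous fun i => v i a := by
    intro a
    by_cases ha : a ∈ G
    · simpa only [v, Set.indicator_of_mem ha] using (hG a ha).1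
    · simpa only [v, Set.indicator_of_notMem ha] using continuous_const
  have hv : ∀ i, StronglyMeasurable (v i) := by
    intro i
    obtain ⟨s, hs, hsl⟩ := mem_closure_iff_seq_limit.1 (hDd i)
    exact stronglyMeasurable_of_tendsto atTop (fun n => hvD (s n) (hs n))
      (tendsto_pi_nhds.2 fun a => ((hvc a).tendsto i).comp hsl)
  refine ⟨fun p => v p.2 p.1, (stronglyMeasurable_uncurry_of_continuous_of_stronglyMeasurable
    hvc hv).comp_measurable measurable_swap, ?_⟩
  filter_upwards [Measure.quasiMeasurePreserving_fst.ae hGu] with p hp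
  simp [v, hp, Function.uncurry]

/-! ### Tent functions and interpolation between random variables. -/

section Interpolation

/-- The truncation of a real number to `[0, 1]`. -/
def clampUnit (x : ℝ) : ℝ := max 0 (min x 1)

/-- The tent function `x ↦ max 0 (1 - |x|)`, as a difference of truncations. -/
def tent (x : ℝ) : ℝ := clampUnit (x + 1) - clampUnit x

theorem continuous_tent : Continuous tent := by
  unfold tent clampUnit; fun_prop

theorem clampUnit_mono : Monotone clampUnit := fun x y h => by
  unfold clampUnit; gcongr

theorem tent_nonneg (x : ℝ) : 0 ≤ tent x :=
  sub_nonneg.2 (clampUnit_mono (by linarith))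

theorem abs_lt_one_of_tent_ne_zero {x : ℝ} (h : tent x ≠ 0) : |x| < 1 := by
  contrapose! h
  unfold tent clampUnit
  rcases le_abs.1 h with h | h
  · rw [min_eq_right (by linarith), min_eq_right h]; simp
  · rw [max_eq_left, max_eq_left] <;> simp <;> grind

/-- Each tent is a difference of consecutive truncations, so the sum telescopes. -/
theorem sum_tent (N : ℕ) {x : ℝ} (h0 : 0 ≤ x) (hN : x ≤ N) :
    ∑ k ∈ Finset.range (N + 1), tent (x - k) = 1 := by
  have h := Finset.sum_range_sub' (fun k : ℕ => clampUnit (x - k + 1)) (N + 1)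
  have h1 : ∀ k : ℕ, tent (x - k)
      = clampUnit (x - k + 1) - clampUnit (x - ((k + 1 : ℕ) : ℝ) + 1) := by
    intro k
    rw [tent]
    congr 2
    push_cast; ring
  simp_rw [h1]
  rw [h]
  have e1 : clampUnit (x - (0 : ℕ) + 1) = 1 := by
    unfold clampUnit
    rw [min_eq_right (by push_cast; linarith)]; simp
  have e2 : clampUnit (x - ((N + 1 : ℕ) : ℝ) + 1) = 0 := by
    unfold clampUnit
    rw [max_eq_left]
    exact (min_le_left _ _).trans (by push_cast; linarith)
  rw [e1, e2, sub_zero]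

variable {Ω : Type*} [MeasurableSpace Ω] {P : Measure Ω}

theorem coeFn_finset_sum {E ι : Type*} [NormedAddCommGroup E] {p : ℝ≥0∞} (s : Finset ι)
    (f : ι → Lp E p P) : ⇑(∑ i ∈ s, f i) =ᵐ[P] fun ω => ∑ i ∈ s, f i ω := by
  classical
  induction s using Finset.induction_on with
  | empty => simpa using! Lp.coeFn_zero E p P
  | insert a s ha ih =>
    rw [Finset.sum_insert ha]
    filter_upwards [Lp.coeFn_add (f a) (∑ i ∈ s, f i), ih] with ω h1 h2
    rw [h1, Pi.add_apply, h2, Finset.sum_insert ha]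

/-- For fixed `ω`, the supremum over `t` of a subconvex combination of the numbers `z i ω` is at
most the largest `|z i ω|`, hence at most their `ℓ²` norm. This is the maximal inequality behind the
chaining argument. -/
theorem norm_sum_smul_le {K ι : Type*} [TopologicalSpace K] [CompactSpace K] (s : Finset ι)
    (w : ι → C(K, ℝ)) (hw : ∀ i ∈ s, ∀ t, 0 ≤ w i t) (hw1 : ∀ t, ∑ i ∈ s, w i t ≤ 1)
    (z : ι → Lp ℝ 2 P) :
    ‖∑ i ∈ s, (ContinuousLinearMap.toSpanSingleton ℝ (w i)).compLpL 2 P (z i)‖ ^ 2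
      ≤ ∑ i ∈ s, ‖z i‖ ^ 2 := by
  set Z := ∑ i ∈ s, (ContinuousLinearMap.toSpanSingleton ℝ (w i)).compLpL 2 P (z i) with hZ
  have hint : ∀ i, Integrable (fun ω => z i ω ^ 2) P := fun i => (Lp.memLp (z i)).integrable_sq
  have hpt : ∀ᵐ ω ∂P, ‖Z ω‖ ^ 2 ≤ ∑ i ∈ s, z i ω ^ 2 := by
    have h1 := coeFn_finset_sum (P := P) s
      fun i => (ContinuousLinearMap.toSpanSingleton ℝ (w i)).compLpL 2 P (z i)
    have h2 : ∀ᵐ ω ∂P, ∀ i ∈ s, (ContinuousLinearMap.toSpanSingleton ℝ (w i)).compLpL 2 P (z i) ω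
        = z i ω • w i := by
      refine (ae_ball_iff s.countable_toSet).2 fun i _ => ?_
      filter_upwards [ContinuousLinearMap.coeFn_compLpL
        (ContinuousLinearMap.toSpanSingleton ℝ (w i)) (z i)] with ω h
      rw [h]
      simp
    filter_upwards [h1, h2] with ω h1 h2
    set R := ∑ i ∈ s, z i ω ^ 2 with hR
    have hR0 : 0 ≤ R := Finset.sum_nonneg fun i _ => sq_nonneg _
    have : ‖Z ω‖ ≤ √R := by
      rw [h1, Finset.sum_congr rfl h2]
      refine (ContinuousMap.norm_le _ (Real.sqrt_nonneg _)).2 fun t => ?_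
      rw [ContinuousMap.sum_apply]
      calc ‖∑ i ∈ s, (z i ω • w i) t‖ ≤ ∑ i ∈ s, ‖(z i ω • w i) t‖ := norm_sum_le _ _
        _ ≤ ∑ i ∈ s, w i t * √R := by
          refine Finset.sum_le_sum fun i hi => ?_
          rw [ContinuousMap.smul_apply, norm_smul, Real.norm_of_nonneg (hw i hi t), mul_comm]
          refine mul_le_mul_of_nonneg_left ?_ (hw i hi t)
          refine Real.abs_le_sqrt ?_
          exact Finset.single_le_sum (f := fun i => z i ω ^ 2) (fun i _ => sq_nonneg _) hi
        _ = (∑ i ∈ s, w i t) * √R := (Finset.sum_mul ..).symm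
        _ ≤ √R := mul_le_of_le_one_left (Real.sqrt_nonneg _) (hw1 t)
    calc ‖Z ω‖ ^ 2 ≤ √R ^ 2 := by gcongr
      _ = R := Real.sq_sqrt hR0
  have hn : ∀ i, ‖z i‖ ^ 2 = ∫ ω, z i ω ^ 2 ∂P := fun i => by
    rw [← norm_sq_classL2 (Lp.memLp (z i)), classL2_coe]
  have hZn : ‖Z‖ ^ 2 = ∫ ω, ‖Z ω‖ ^ 2 ∂P := by
    have hm : MemLp (fun ω => ‖Z ω‖) 2 P := (Lp.memLp Z).norm
    have := norm_sq_classL2 hm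
    rw [← this, classL2_of_memLp hm, Lp.norm_toLp, Lp.norm_def, eLpNorm_norm]
  rw [hZn, Finset.sum_congr rfl fun i _ => hn i, ← integral_finsetSum _ fun i _ => hint i]
  exact integral_mono_ae (Lp.memLp Z).norm.integrable_sq
    (integrable_finsetSum _ fun i _ => hint i) hpt

end Interpolation

/-! ### Kolmogorov's continuity theorem by dyadic interpolation. -/

section Kolmogorov

variable {Ω : Type*} [MeasurableSpace Ω] {P : Measure Ω} {T : ℝ}

/-- Evaluation at time `t` of a square integrable random continuous path. -/
def evalLp (P : Measure Ω) (t : Set.Icc (0 : ℝ) T) :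
    Lp C(Set.Icc (0 : ℝ) T, ℝ) 2 P →L[ℝ] Lp ℝ 2 P :=
  (ContinuousMap.evalCLM ℝ t).compLpL 2 P

/-- Two continuous paths that agree almost surely at each time agree almost surely on a countable
dense set of times, hence everywhere. This uniqueness later makes the choice of versions linear. -/
theorem ext_evalLp (hT : 0 ≤ T) {X Z : Lp C(Set.Icc (0 : ℝ) T, ℝ) 2 P}
    (h : ∀ t, evalLp P t X = evalLp P t Z) : X = Z := by
  have : Nonempty (Set.Icc (0 : ℝ) T) := ⟨⟨0, le_rfl, hT⟩⟩
  obtain ⟨D, hD, hDd⟩ := TopologicalSpace.exists_countable_dense (Set.Icc (0 : ℝ) T)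
  refine Lp.ext ?_
  have h1 : ∀ᵐ ω ∂P, ∀ t ∈ D, X ω t = Z ω t := by
    refine (ae_ball_iff hD).2 fun t _ => ?_
    filter_upwards [(ContinuousMap.evalCLM ℝ t : C(Set.Icc (0 : ℝ) T, ℝ) →L[ℝ] ℝ).coeFn_compLpL (p := 2) X,
      (ContinuousMap.evalCLM ℝ t : C(Set.Icc (0 : ℝ) T, ℝ) →L[ℝ] ℝ).coeFn_compLpL (p := 2) Z] with ω hX hZ
    have := h t
    simp only [evalLp] at this
    rw [this, hZ] at hX
    exact hX.symm
  filter_upwards [h1] with ω hω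
  exact DFunLike.coe_injective ((X ω).continuous.ext_on hDd (Z ω).continuous hω)

/-- The tent function centred at `k T / 2 ^ n`, of width `T / 2 ^ n`. -/
def dyadicTent (T : ℝ) (n k : ℕ) : C(Set.Icc (0 : ℝ) T, ℝ) where
  toFun t := tent (2 ^ n * t / T - k)
  continuous_toFun := continuous_tent.comp (by fun_prop)

theorem sum_dyadicTent (hT : 0 < T) (n : ℕ) (t : Set.Icc (0 : ℝ) T) :
    ∑ k ∈ Finset.range (2 ^ n + 1), dyadicTent T n k t = 1 := by
  refine sum_tent (2 ^ n) ?_ ?_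
  · exact div_nonneg (mul_nonneg (by positivity) t.2.1) hT.le
  · rw [div_le_iff₀ hT]
    push_cast
    exact mul_le_mul_of_nonneg_left t.2.2 (by positivity)

theorem abs_sub_lt_of_dyadicTent_ne_zero (hT : 0 < T) {n k : ℕ} {t : Set.Icc (0 : ℝ) T}
    (h : dyadicTent T n k t ≠ 0) : |(t : ℝ) - T * (k / 2 ^ n)| < T * (1 / 2) ^ n := by
  have h1 := abs_lt_one_of_tent_ne_zero h
  have h2 : (t : ℝ) - T * (k / 2 ^ n) = T * (1 / 2) ^ n * (2 ^ n * t / T - k) := by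
    have : (2 : ℝ) ^ n * (1 / 2) ^ n = 1 := by rw [← mul_pow]; norm_num
    have h3 : (k : ℝ) / 2 ^ n = k * (1 / 2) ^ n := by rw [one_div, inv_pow]; rfl
    rw [h3]
    field_simp
    linear_combination (-(t : ℝ)) * this
  rw [h2, abs_mul, abs_of_pos (by positivity)]
  exact mul_lt_of_lt_one_right (by positivity) h1

theorem dyadic_mem (hT : 0 < T) {n k : ℕ} (hk : k ∈ Finset.range (2 ^ n + 1)) :
    T * (k / 2 ^ n : ℝ) ∈ Set.Icc (0 : ℝ) T := by
  have hk' : (k : ℝ) ≤ 2 ^ n := by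
    exact_mod_cast Nat.lt_succ_iff.1 (Finset.mem_range.1 hk)
  refine ⟨by positivity, mul_le_of_le_one_right hT.le ?_⟩
  rwa [div_le_one (by positivity)]

/-- The piecewise linear interpolation of the process `a` at the dyadic times `k T / 2 ^ n`. -/
def dyadicInterp (P : Measure Ω) (T : ℝ) (a : ℝ → Lp ℝ 2 P) (n : ℕ) :
    Lp C(Set.Icc (0 : ℝ) T, ℝ) 2 P :=
  ∑ k ∈ Finset.range (2 ^ n + 1),
    (ContinuousLinearMap.toSpanSingleton ℝ (dyadicTent T n k)).compLpL 2 P (a (T * (k / 2 ^ n)))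

theorem evalLp_span (w : C(Set.Icc (0 : ℝ) T, ℝ)) (z : Lp ℝ 2 P) (t : Set.Icc (0 : ℝ) T) :
    evalLp P t ((ContinuousLinearMap.toSpanSingleton ℝ w).compLpL 2 P z) = w t • z := by
  refine Lp.ext ?_
  filter_upwards [(ContinuousMap.evalCLM ℝ t : C(Set.Icc (0 : ℝ) T, ℝ) →L[ℝ] ℝ).coeFn_compLpL (p := 2)
      ((ContinuousLinearMap.toSpanSingleton ℝ w).compLpL 2 P z),
    (ContinuousLinearMap.toSpanSingleton ℝ w).coeFn_compLpL (p := 2) z,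
    Lp.coeFn_smul (w t) z] with ω h1 h2 h3
  rw [evalLp, h1, h2, h3]
  simp [mul_comm]

theorem norm_evalLp_dyadicInterp_sub_le (hT : 0 < T) (a : ℝ → Lp ℝ 2 P) {M : ℝ}
    (ha : ∀ s ∈ Set.Icc 0 T, ∀ t ∈ Set.Icc 0 T, ‖a t - a s‖ ^ 2 ≤ M ^ 2 * |t - s| ^ (3 / 2 : ℝ))
    (n : ℕ) (t : Set.Icc (0 : ℝ) T) :
    ‖evalLp P t (dyadicInterp P T a n) - a t‖ ≤ √(M ^ 2 * (T * (1 / 2) ^ n) ^ (3 / 2 : ℝ)) := by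
  have h1 : evalLp P t (dyadicInterp P T a n) - a t
      = ∑ k ∈ Finset.range (2 ^ n + 1), dyadicTent T n k t • (a (T * (k / 2 ^ n)) - a t) := by
    simp_rw [smul_sub]
    rw [Finset.sum_sub_distrib, ← Finset.sum_smul, sum_dyadicTent hT, one_smul, dyadicInterp,
      map_sum]
    simp_rw [evalLp_span]
  rw [h1]
  refine (norm_sum_le _ _).trans ?_
  set R := √(M ^ 2 * (T * (1 / 2) ^ n) ^ (3 / 2 : ℝ)) with hR
  calc ∑ k ∈ Finset.range (2 ^ n + 1), ‖dyadicTent T n k t • (a (T * (k / 2 ^ n)) - a t)‖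
      ≤ ∑ k ∈ Finset.range (2 ^ n + 1), dyadicTent T n k t * R := by
        refine Finset.sum_le_sum fun k hk => ?_
        have hk0 : 0 ≤ dyadicTent T n k t := tent_nonneg _
        rw [norm_smul, Real.norm_of_nonneg hk0]
        by_cases h0 : dyadicTent T n k t = 0
        · simp [h0]
        refine mul_le_mul_of_nonneg_left (Real.le_sqrt_of_sq_le ?_) (tent_nonneg _)
        refine (ha _ t.2 _ (dyadic_mem hT hk)).trans ?_
        rw [abs_sub_comm]
        gcongr
        exact (abs_sub_lt_of_dyadicTent_ne_zero hT h0).le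
    _ = R := by rw [← Finset.sum_mul, sum_dyadicTent hT, one_mul]

/-- Products of the tents of the two levels form a common partition of unity, with weights on
increments between a fine and a coarse dyadic time. Only overlapping tents contribute: there are
`O(2 ^ n)` such pairs, at times `O(2 ^ (-n))` apart. -/
theorem norm_dyadicInterp_succ_sub_le (hT : 0 < T) (a : ℝ → Lp ℝ 2 P) {M : ℝ}
    (ha : ∀ s ∈ Set.Icc 0 T, ∀ t ∈ Set.Icc 0 T, ‖a t - a s‖ ^ 2 ≤ M ^ 2 * |t - s| ^ (3 / 2 : ℝ))
    (n : ℕ) :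
    ‖dyadicInterp P T a (n + 1) - dyadicInterp P T a n‖ ^ 2
      ≤ 10 * 2 ^ n * (M ^ 2 * (2 * T * (1 / 2) ^ n) ^ (3 / 2 : ℝ)) := by
  classical
  set U := Finset.range (2 ^ (n + 1) + 1) ×ˢ Finset.range (2 ^ n + 1) with hU
  let w : ℕ × ℕ → C(Set.Icc (0 : ℝ) T, ℝ) := fun p => dyadicTent T (n + 1) p.1 * dyadicTent T n p.2
  let z : ℕ × ℕ → Lp ℝ 2 P := fun p => a (T * (p.1 / 2 ^ (n + 1))) - a (T * (p.2 / 2 ^ n))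
  have hw0 : ∀ p t, 0 ≤ w p t := fun p t => mul_nonneg (tent_nonneg _) (tent_nonneg _)
  have hws : ∀ t, ∑ p ∈ U, w p t = 1 := by
    intro t
    rw [hU, Finset.sum_product]
    have : ∀ i j : ℕ, w (i, j) t = dyadicTent T (n + 1) i t * dyadicTent T n j t := fun _ _ => rfl
    simp_rw [this, ← Finset.mul_sum, sum_dyadicTent hT, mul_one, sum_dyadicTent hT]
  set S := U.filter fun p => w p ≠ 0 with hS
  have hsum : dyadicInterp P T a (n + 1) - dyadicInterp P T a n
      = ∑ p ∈ S, (ContinuousLinearMap.toSpanSingleton ℝ (w p)).compLpL 2 P (z p) := by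
    have h1 : ∑ p ∈ S, (ContinuousLinearMap.toSpanSingleton ℝ (w p)).compLpL 2 P (z p)
        = ∑ p ∈ U, (ContinuousLinearMap.toSpanSingleton ℝ (w p)).compLpL 2 P (z p) := by
      refine Finset.sum_filter_of_ne fun p _ hp hw => hp ?_
      refine ext_evalLp hT.le fun t => ?_
      rw [evalLp_span, hw]
      simp
    rw [h1]
    refine ext_evalLp hT.le fun t => ?_
    rw [map_sub, map_sum, dyadicInterp, dyadicInterp, map_sum, map_sum]
    simp_rw [evalLp_span]
    have h2 : ∀ p, w p t • z p = (dyadicTent T (n + 1) p.1 t * dyadicTent T n p.2 t) •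
        a (T * (p.1 / 2 ^ (n + 1))) - (dyadicTent T (n + 1) p.1 t * dyadicTent T n p.2 t) •
        a (T * (p.2 / 2 ^ n)) := fun p => smul_sub _ _ _
    simp_rw [h2]
    rw [Finset.sum_sub_distrib, hU, Finset.sum_product, Finset.sum_product_right]
    simp_rw [← Finset.sum_smul, ← Finset.mul_sum, ← Finset.sum_mul, sum_dyadicTent hT, mul_one,
      one_mul]
  -- Overlapping tents have centres closer than the sum of their half-widths, `1 + 1/2` in units of
  -- `T / 2 ^ n`.
  have hclose : ∀ p ∈ S, |T * (p.1 / 2 ^ (n + 1) : ℝ) - T * (p.2 / 2 ^ n)|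
      < 3 / 2 * (T * (1 / 2) ^ n) := by
    intro p hp
    obtain ⟨t, ht⟩ : ∃ t, w p t ≠ 0 := by
      by_contra! h
      exact (Finset.mem_filter.1 hp).2 (ContinuousMap.ext h)
    have h1 := abs_sub_lt_of_dyadicTent_ne_zero hT (left_ne_zero_of_mul ht)
    have h2 := abs_sub_lt_of_dyadicTent_ne_zero hT (right_ne_zero_of_mul ht)
    simp only [pow_succ] at h1 ⊢
    rw [abs_lt] at h1 h2 ⊢
    constructor <;> linarith
  have hcard : (S.card : ℝ) ≤ 10 * 2 ^ n := by
    -- In fine mesh units `|p.1 - 2 p.2| < 3`, so each coarse index meets at most five fine ones.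
    -- The shift by `2` keeps the offset a natural number, and `5 (2 ^ n + 1) ≤ 10 * 2 ^ n`.
    have hsub : S ⊆ (Finset.range (2 ^ n + 1) ×ˢ Finset.range 5).image
        fun q => (2 * q.1 + q.2 - 2, q.1) := by
      intro p hp
      have h1 := hclose p hp
      have h2 : T * (p.1 / 2 ^ (n + 1) : ℝ) - T * (p.2 / 2 ^ n)
          = T * (1 / 2) ^ n * ((p.1 : ℝ) / 2 - p.2) := by
        rw [one_div, inv_pow, pow_succ]; field_simp
      rw [h2, abs_mul, abs_of_pos (by positivity), mul_comm (3 / 2 : ℝ),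
        mul_lt_mul_iff_right₀ (by positivity), abs_lt] at h1
      have h3 : (p.1 : ℝ) < 2 * p.2 + 3 := by linarith
      have h4 : (2 * p.2 : ℝ) < p.1 + 3 := by linarith
      have h3' : p.1 < 2 * p.2 + 3 := by exact_mod_cast h3
      have h4' : 2 * p.2 < p.1 + 3 := by exact_mod_cast h4
      have hp2 := (Finset.mem_product.1 (Finset.mem_filter.1 hp).1).2
      refine Finset.mem_image.2 ⟨(p.2, p.1 + 2 - 2 * p.2), ?_, ?_⟩
      · rw [Finset.mem_product]
        exact ⟨hp2, Finset.mem_range.2 (by dsimp only; omega)⟩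
      · ext <;> dsimp only
        omega
    have h1 := (Finset.card_le_card hsub).trans Finset.card_image_le
    rw [Finset.card_product, Finset.card_range, Finset.card_range] at h1
    have h2 : S.card ≤ 10 * 2 ^ n := h1.trans (by have := Nat.one_le_two_pow (n := n); omega)
    exact_mod_cast h2
  rw [hsum]
  refine (norm_sum_smul_le S w (fun p _ t => hw0 p t) (fun t => ?_) z).trans ?_
  · rw [← hws t]
    exact Finset.sum_le_sum_of_subset_of_nonneg (Finset.filter_subset _ _) fun p _ _ => hw0 p t
  · refine (Finset.sum_le_card_nsmul S _ (M ^ 2 * (2 * T * (1 / 2) ^ n) ^ (3 / 2 : ℝ))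
      fun p hp => ?_).trans ?_
    · have hpU := Finset.mem_product.1 (Finset.mem_filter.1 hp).1
      refine (ha _ (dyadic_mem hT hpU.2) _ (dyadic_mem hT hpU.1)).trans ?_
      gcongr
      refine (hclose p hp).le.trans ?_
      have : 0 < T * (1 / 2) ^ n := by positivity
      linarith
    · rw [nsmul_eq_mul]
      gcongr

/-- **Kolmogorov's continuity theorem**, in quantitative form, for square integrable processes. -/
theorem exists_continuous_version (hT : 0 < T) : ∃ K : ℝ, 0 ≤ K ∧
    ∀ {Ω : Type*} [MeasurableSpace Ω] {P : Measure Ω} (a : ℝ → Lp ℝ 2 P) {M : ℝ}, 0 ≤ M →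
      a 0 = 0 →
      (∀ s ∈ Set.Icc 0 T, ∀ t ∈ Set.Icc 0 T,
        ‖a t - a s‖ ^ 2 ≤ M ^ 2 * |t - s| ^ (3 / 2 : ℝ)) →
      ∃ X : Lp C(Set.Icc (0 : ℝ) T, ℝ) 2 P, (∀ t, evalLp P t X = a t) ∧ ‖X‖ ≤ K * M := by
  -- The squared distance between consecutive levels is of order `2 ^ n * 2 ^ (-3n/2) = 2 ^ (-n/2) =
  -- ρ ^ (2n)`, so the distances are summable with ratio `ρ`.
  set ρ : ℝ := √√(1 / 2) with hρ
  have hρ1 : ρ < 1 := by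
    rw [hρ, Real.sqrt_lt' one_pos, Real.sqrt_lt' (by positivity)]; norm_num
  have hρ0 : 0 ≤ ρ := Real.sqrt_nonneg _
  have hρ4 : ρ ^ 4 = 1 / 2 := by
    have : ρ ^ 4 = (ρ ^ 2) ^ 2 := by ring
    rw [this, hρ, Real.sq_sqrt (by positivity), Real.sq_sqrt (by positivity)]
  set B : ℝ := √(10 * (2 * T) ^ (3 / 2 : ℝ)) with hB
  set B0 : ℝ := √(T ^ (3 / 2 : ℝ)) with hB0
  have hpow : ∀ n : ℕ, ((1 / 2 : ℝ) ^ n) ^ (3 / 2 : ℝ) = (ρ ^ n) ^ 6 := by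
    intro n
    rw [← hρ4, ← pow_mul, ← Real.rpow_natCast, ← Real.rpow_natCast, ← Real.rpow_natCast,
      ← Real.rpow_mul hρ0, ← Real.rpow_mul hρ0]
    congr 1; push_cast; ring
  refine ⟨B0 + B / (1 - ρ), add_nonneg (Real.sqrt_nonneg _)
    (div_nonneg (Real.sqrt_nonneg _) (by linarith)), ?_⟩
  intro Ω _ P a M hM h0 ha
  have hstep : ∀ n, dist (dyadicInterp P T a n) (dyadicInterp P T a (n + 1)) ≤ B * M * ρ ^ n := by
    intro n
    rw [dist_comm, dist_eq_norm]
    refine le_of_sq_le_sq ?_ (by positivity)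
    refine (norm_dyadicInterp_succ_sub_le hT a ha n).trans (le_of_eq ?_)
    rw [Real.mul_rpow (by positivity) (by positivity), hpow, mul_pow, mul_pow, hB,
      Real.sq_sqrt (by positivity)]
    have : (2 : ℝ) ^ n * (ρ ^ n) ^ 4 = 1 := by
      rw [← pow_mul, mul_comm n, pow_mul, hρ4, ← mul_pow]; norm_num
    linear_combination (10 * (2 * T) ^ (3 / 2 : ℝ) * M ^ 2 * (ρ ^ n) ^ 2) * this
  obtain ⟨X, hX⟩ := cauchySeq_tendsto_of_complete (cauchySeq_of_le_geometric ρ (B * M) hρ1 hstep)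
  refine ⟨X, fun t => ?_, ?_⟩
  · refine tendsto_nhds_unique (((evalLp P t).continuous.tendsto X).comp hX) ?_
    rw [tendsto_iff_norm_sub_tendsto_zero]
    refine squeeze_zero (fun _ => norm_nonneg _)
      (fun n => norm_evalLp_dyadicInterp_sub_le hT a ha n t) ?_
    have h1 : Tendsto (fun n : ℕ => (ρ ^ n) ^ 6) atTop (𝓝 0) := by
      simpa using (tendsto_pow_atTop_nhds_zero_of_lt_one hρ0 hρ1).pow 6
    have h2 := ((h1.const_mul (T ^ (3 / 2 : ℝ))).const_mul (M ^ 2)).sqrt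
    simp only [mul_zero, Real.sqrt_zero] at h2
    refine h2.congr fun n => ?_
    rw [Real.mul_rpow hT.le (by positivity), hpow]
  · have h1 := dist_le_of_le_geometric_of_tendsto₀ ρ (B * M) hρ1 hstep hX
    -- Level zero uses only the times `0` and `T`; since `a 0 = 0`, its norm is controlled by a
    -- single increment.
    have h2 : ‖dyadicInterp P T a 0‖ ≤ B0 * M := by
      refine le_of_sq_le_sq ?_ (by positivity)
      refine (norm_sum_smul_le _ _ (fun k _ t => tent_nonneg _)
        (fun t => (sum_dyadicTent hT 0 t).le) _).trans ?_
      have h3 := ha 0 ⟨le_rfl, hT.le⟩ T ⟨hT.le, le_rfl⟩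
      rw [h0, sub_zero, sub_zero, abs_of_pos hT] at h3
      have h5 : Finset.range (2 ^ 0 + 1) = {0, 1} := rfl
      rw [h5, Finset.sum_pair zero_ne_one]
      simp only [pow_zero, Nat.cast_zero, mul_zero, h0, norm_zero, Nat.cast_one, div_one,
        mul_one]
      rw [mul_pow, hB0, Real.sq_sqrt (by positivity)]
      linarith
    have h4 : ‖X‖ ≤ ‖dyadicInterp P T a 0‖ + dist (dyadicInterp P T a 0) X := by
      rw [dist_eq_norm, ← norm_neg (dyadicInterp P T a 0 - X), neg_sub]
      simpa using norm_add_le (dyadicInterp P T a 0) (X - dyadicInterp P T a 0)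
    calc ‖X‖ ≤ B0 * M + B * M / (1 - ρ) := by linarith
      _ = (B0 + B / (1 - ρ)) * M := by ring

end Kolmogorov

/-! ### Moments of Gaussian variables; Gaussian laws under `L²` limits. -/

section Gaussian

open scoped NNReal

variable {Ω : Type*} [MeasurableSpace Ω] {P : Measure Ω}

theorem memLp_of_hasLaw_gaussian {X : Ω → ℝ} {v : ℝ≥0} (h : HasLaw X (gaussianReal 0 v) P)
    (p : ℝ≥0) : MemLp X p P := by
  have h1 := memLp_id_gaussianReal (μ := 0) (v := v) p
  rw [← h.map_eq] at h1
  exact (memLp_map_measure_iff h1.1 h.aemeasurable).1 h1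

theorem integral_pow_four_gaussianReal (v : ℝ≥0) :
    ∫ x, x ^ 4 ∂gaussianReal 0 v = 3 * (v : ℝ) ^ 2 := by
  have h := iteratedDeriv_mgf_zero (X := id) (μ := gaussianReal 0 v) (by simp) 4
  have e : ∫ x, x ^ 4 ∂gaussianReal 0 v = ∫ x, (id ^ 4 : ℝ → ℝ) x ∂gaussianReal 0 v := rfl
  rw [e, ← h, mgf_id_gaussianReal]
  have hF : ∀ t : ℝ, HasDerivAt (fun t => Real.exp ((0 : ℝ) * t + v * t ^ 2 / 2))
      (v * t * Real.exp (0 * t + v * t ^ 2 / 2)) t := by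
    intro t
    have h1 : HasDerivAt (fun t : ℝ => (0 : ℝ) * t + v * t ^ 2 / 2) (v * t) t := by
      have := ((hasDerivAt_id t).const_mul 0).add
        ((((hasDerivAt_id t).pow 2).const_mul (v : ℝ)).div_const 2)
      convert! this using 1
      simp
      ring
    convert! h1.exp using 1
    ring
  have d1 : deriv (fun t => Real.exp ((0 : ℝ) * t + v * t ^ 2 / 2))
      = fun t => v * t * Real.exp (0 * t + v * t ^ 2 / 2) := funext fun t => (hF t).deriv
  have d2 : deriv (fun t => v * t * Real.exp ((0 : ℝ) * t + v * t ^ 2 / 2))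
      = fun t => (v + v ^ 2 * t ^ 2) * Real.exp (0 * t + v * t ^ 2 / 2) := funext fun t => by
    have := ((hasDerivAt_id t).const_mul (v : ℝ)).mul (hF t)
    refine (HasDerivAt.deriv this).trans ?_
    simp; ring
  have d3 : deriv (fun t => (v + v ^ 2 * t ^ 2) * Real.exp ((0 : ℝ) * t + v * t ^ 2 / 2))
      = fun t => (3 * v ^ 2 * t + v ^ 3 * t ^ 3) * Real.exp (0 * t + v * t ^ 2 / 2) :=
    funext fun t => by
    have := ((((hasDerivAt_id t).pow 2).const_mul ((v : ℝ) ^ 2)).const_add (v : ℝ)).mul (hF t)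
    refine (HasDerivAt.deriv this).trans ?_
    simp; ring
  have d4 : deriv (fun t : ℝ => (3 * v ^ 2 * t + v ^ 3 * t ^ 3)
      * Real.exp ((0 : ℝ) * t + v * t ^ 2 / 2)) 0 = 3 * (v : ℝ) ^ 2 := by
    have := (((hasDerivAt_id (0 : ℝ)).const_mul (3 * (v : ℝ) ^ 2)).add
      (((hasDerivAt_id (0 : ℝ)).pow 3).const_mul ((v : ℝ) ^ 3))).mul (hF 0)
    refine (HasDerivAt.deriv this).trans ?_
    simp
  rw [iteratedDeriv_succ, iteratedDeriv_succ, iteratedDeriv_succ, iteratedDeriv_one, d1, d2, d3, d4]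

theorem integral_pow_four_of_hasLaw {X : Ω → ℝ} {v : ℝ≥0} (h : HasLaw X (gaussianReal 0 v) P) :
    ∫ ω, X ω ^ 4 ∂P = 3 * (v : ℝ) ^ 2 := by
  rw [← integral_pow_four_gaussianReal, ← h.integral_comp (f := fun x => x ^ 4) (by fun_prop)]
  rfl

theorem integral_sq_of_hasLaw {X : Ω → ℝ} {v : ℝ≥0} (h : HasLaw X (gaussianReal 0 v) P) :
    ∫ ω, X ω ^ 2 ∂P = v := by
  have h1 : ∫ x, x ^ 2 ∂gaussianReal 0 v = v := by
    have := variance_fun_id_gaussianReal (μ := 0) (v := v)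
    rw [variance_eq_integral (by fun_prop)] at this
    simpa using this
  rw [← h1, ← h.integral_comp (f := fun x => x ^ 2) (by fun_prop)]
  rfl

/-- Isserlis' formula for `E[X² Z²]`. -/
theorem integral_sq_mul_sq_of_hasLaw {X Z : Ω → ℝ} {a b p q : ℝ≥0}
    (hX : HasLaw X (gaussianReal 0 a) P) (hZ : HasLaw Z (gaussianReal 0 b) P)
    (hp : HasLaw (fun ω => X ω + Z ω) (gaussianReal 0 p) P)
    (hq : HasLaw (fun ω => X ω - Z ω) (gaussianReal 0 q) P) :
    ∫ ω, X ω ^ 2 * Z ω ^ 2 ∂P = ((p : ℝ) ^ 2 + q ^ 2) / 4 - (a ^ 2 + b ^ 2) / 2 := by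
  have h4 : ∀ {U : Ω → ℝ} {v : ℝ≥0}, HasLaw U (gaussianReal 0 v) P →
      Integrable (fun ω => U ω ^ 4) P := fun h => by
    have := (memLp_of_hasLaw_gaussian h 4).integrable_norm_pow (p := 4) (by norm_num)
    simpa [Even.pow_abs (show Even 4 by decide)] using this
  have i1 : Integrable (fun ω => (X ω + Z ω) ^ 4 + (X ω - Z ω) ^ 4) P := (h4 hp).add (h4 hq)
  have i2 : Integrable (fun ω => 2 * (X ω ^ 4 + Z ω ^ 4)) P := ((h4 hX).add (h4 hZ)).const_mul 2
  -- Polarization reduces the mixed moment to fourth moments of `X`, `Z` and `X ± Z`, so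
  -- one-dimensional Gaussian laws suffice.
  have e : ∀ ω, X ω ^ 2 * Z ω ^ 2 = (1 / 12) * (((X ω + Z ω) ^ 4 + (X ω - Z ω) ^ 4)
      - 2 * (X ω ^ 4 + Z ω ^ 4)) := fun ω => by ring
  simp_rw [e]
  rw [integral_const_mul, integral_sub i1 i2,
    integral_add (h4 hp) (h4 hq), integral_const_mul, integral_add (h4 hX) (h4 hZ),
    integral_pow_four_of_hasLaw hp, integral_pow_four_of_hasLaw hq, integral_pow_four_of_hasLaw hX,
    integral_pow_four_of_hasLaw hZ]
  ring

theorem norm_integral_le_norm_Lp [IsProbabilityMeasure P] (f : Lp ℝ 2 P) :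
    ∫ ω, |f ω| ∂P ≤ ‖f‖ := by
  have h1 : MemLp f 1 P := (Lp.memLp f).mono_exponent (by norm_num)
  have h2 := eLpNorm_le_eLpNorm_of_exponent_le (p := 1) (q := 2) (by norm_num)
    (Lp.memLp f).aestronglyMeasurable
  rw [Lp.norm_def]
  have h3 : ∫ ω, |f ω| ∂P = (eLpNorm f 1 P).toReal := by
    rw [eLpNorm_one_eq_lintegral_enorm]
    exact integral_norm_eq_lintegral_enorm h1.1
  rw [h3]
  exact ENNReal.toReal_mono (Lp.eLpNorm_ne_top f) h2

/-- As `|e^{ia} - e^{ib}| ≤ |a - b|`, the characteristic function is Lipschitz in the random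
variable. Gaussian laws with prescribed variance therefore pass to `L²` limits. -/
theorem continuous_integral_exp_mul_I [IsProbabilityMeasure P] (t : ℝ) :
    Continuous fun f : Lp ℝ 2 P => ∫ ω, Complex.exp (t * f ω * Complex.I) ∂P := by
  have hint : ∀ f : Lp ℝ 2 P, Integrable (fun ω => Complex.exp (t * f ω * Complex.I)) P := by
    intro f
    refine Integrable.of_bound ?_ 1 (ae_of_all _ fun ω => ?_)
    · have hf := (Lp.memLp f).aestronglyMeasurable
      exact (by fun_prop : Continuous fun x : ℝ =>
        Complex.exp (t * x * Complex.I)).comp_aestronglyMeasurable hf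
    · rw [← Complex.ofReal_mul, Complex.norm_exp_ofReal_mul_I]
  refine LipschitzWith.continuous (K := ⟨|t|, abs_nonneg t⟩) (LipschitzWith.of_dist_le_mul ?_)
  intro f g
  rw [dist_eq_norm, dist_eq_norm, ← integral_sub (hint f) (hint g)]
  refine (norm_integral_le_integral_norm _).trans ?_
  have hb : ∀ᵐ ω ∂P, ‖Complex.exp (t * f ω * Complex.I) - Complex.exp (t * g ω * Complex.I)‖
      ≤ |t| * |(f - g) ω| := by
    filter_upwards [Lp.coeFn_sub f g] with ω hω
    rw [hω, Pi.sub_apply]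
    have e : Complex.exp (t * f ω * Complex.I) - Complex.exp (t * g ω * Complex.I)
        = Complex.exp ((t * g ω : ℝ) * Complex.I)
          * (Complex.exp (Complex.I * (t * (f ω - g ω) : ℝ)) - 1) := by
      rw [mul_sub, ← Complex.exp_add, mul_one]
      push_cast
      congr 2
      ring
    rw [e, norm_mul, Complex.norm_exp_ofReal_mul_I, one_mul, ← abs_mul]
    exact Real.norm_exp_I_mul_ofReal_sub_one_le
  refine (integral_mono_ae ((hint f).sub (hint g)).norm
    (((Lp.memLp (f - g)).integrable (by norm_num)).abs.const_mul _) hb).trans ?_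
  rw [integral_const_mul]
  exact mul_le_mul_of_nonneg_left (norm_integral_le_norm_Lp _) (abs_nonneg t)

theorem hasLaw_gaussian_iff [IsProbabilityMeasure P] (f : Lp ℝ 2 P) (v : ℝ≥0) :
    HasLaw f (gaussianReal 0 v) P ↔
      ∀ t : ℝ, ∫ ω, Complex.exp (t * f ω * Complex.I) ∂P = Complex.exp (-(v * t ^ 2 / 2)) := by
  have hm := (Lp.memLp f).aestronglyMeasurable.aemeasurable
  have h1 : ∀ t : ℝ, charFun (P.map f) t = ∫ ω, Complex.exp (t * f ω * Complex.I) ∂P := by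
    intro t
    rw [charFun_apply_real, integral_map hm]
    exact (by fun_prop : Continuous fun x : ℝ =>
      Complex.exp (t * x * Complex.I)).aestronglyMeasurable
  have h2 : ∀ t : ℝ, charFun (gaussianReal 0 v) t = Complex.exp (-(v * t ^ 2 / 2)) := by
    intro t
    rw [charFun_gaussianReal]
    simp
  constructor
  · intro h t
    rw [← h1, ← h2, h.map_eq]
  · intro h
    have : IsProbabilityMeasure (P.map f) := Measure.isProbabilityMeasure_map hm
    refine ⟨hm, Measure.ext_of_charFun (funext fun t => ?_)⟩
    rw [h1, h2, h]

end Gaussian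

/-! ### White noise on `L²(ℝ)` and its Wick square. -/

section WhiteNoise

variable {Ω : Type*} [MeasurableSpace Ω] {P : Measure Ω} {χ : ℝ} {W : Ω → TemperedDist}

theorem IsWhiteNoise.memLp (hW : IsWhiteNoise P χ W) (u : 𝓢(ℝ, ℝ)) : MemLp (fun ω => W ω u) 2 P :=
  memLp_of_hasLaw_gaussian (hW u) 2

theorem norm_sq_toLp (u : 𝓢(ℝ, ℝ)) : ‖u.toLp 2 (volume : Measure ℝ)‖ ^ 2 = ∫ x, u x ^ 2 := by
  rw [← real_inner_self_eq_norm_sq, L2.inner_def]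
  refine integral_congr_ae ?_
  filter_upwards [u.coeFn_toLp 2 volume] with x hx
  rw [hx]
  simp [sq]

theorem IsWhiteNoise.norm_classL2 (hχ : 0 ≤ χ) (hW : IsWhiteNoise P χ W) (u : 𝓢(ℝ, ℝ)) :
    ‖classL2 P fun ω => W ω u‖ = √χ * ‖u.toLp 2 (volume : Measure ℝ)‖ := by
  refine (sq_eq_sq₀ (norm_nonneg _) (by positivity)).1 ?_
  rw [norm_sq_classL2 (hW.memLp u), integral_sq_of_hasLaw (hW u), mul_pow, norm_sq_toLp,
    Real.sq_sqrt hχ, Real.coe_toNNReal]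
  exact mul_nonneg hχ (integral_nonneg fun x => sq_nonneg _)

/-- A white noise extends to a Gaussian isometry (up to a constant) on `L²(ℝ)`, and this extension
is the one given by `evalL2`. -/
theorem IsWhiteNoise.exists_clm [IsProbabilityMeasure P] (hχ : 0 ≤ χ) (hW : IsWhiteNoise P χ W) :
    ∃ J : Lp ℝ 2 (volume : Measure ℝ) →L[ℝ] Lp ℝ 2 P,
      (∀ (f : ℝ → ℝ) (hf : MemLp f 2 volume), evalL2 P W f = J (hf.toLp f)) ∧
      (∀ u : 𝓢(ℝ, ℝ), J (u.toLp 2) = classL2 P fun ω => W ω u) ∧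
      ∀ f, HasLaw (J f) (gaussianReal 0 (χ * ‖f‖ ^ 2).toNNReal) P := by
  let l : 𝓢(ℝ, ℝ) →ₗ[ℝ] Lp ℝ 2 P :=
    { toFun := fun u => classL2 P fun ω => W ω u
      map_add' := fun u v => by
        rw [← classL2_add (hW.memLp u) (hW.memLp v)]; simp
      map_smul' := fun c u => by
        rw [RingHom.id_apply, ← classL2_smul (hW.memLp u)]; simp }
  obtain ⟨J, hJ⟩ := exists_clm_comp_eq
    (SchwartzMap.toLpCLM ℝ ℝ 2 (volume : Measure ℝ)).toLinearMap l (√χ)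
    fun u => (hW.norm_classL2 hχ u).le
  have hJ' : ∀ u : 𝓢(ℝ, ℝ), J (u.toLp 2) = classL2 P fun ω => W ω u := hJ
  have hdense : DenseRange fun u : 𝓢(ℝ, ℝ) => u.toLp 2 (volume : Measure ℝ) :=
    SchwartzMap.denseRange_toLpCLM (F := ℝ) ENNReal.ofNat_ne_top
  refine ⟨J, fun f hf => ?_, hJ', fun f => ?_⟩
  · have hcomap : comap (fun u : 𝓢(ℝ, ℝ) => eLpNorm (fun y => u y - f y) 2 volume) (𝓝 0)
        = comap (fun u : 𝓢(ℝ, ℝ) => u.toLp 2 (volume : Measure ℝ)) (𝓝 (hf.toLp f)) := by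
      have h1 : (fun u : 𝓢(ℝ, ℝ) => eLpNorm (fun y => u y - f y) 2 volume)
          = fun u : 𝓢(ℝ, ℝ) => edist (u.toLp 2 (volume : Measure ℝ)) (hf.toLp f) := by
        funext u
        rw [SchwartzMap.toLp, Lp.edist_toLp_toLp]
        rfl
      have h2 : 𝓝 (hf.toLp f) = comap (fun g => edist g (hf.toLp f)) (𝓝 0) :=
        Metric.nhds_basis_eball.eq_of_same_basis (ENNReal.nhds_zero_basis.comap _)
      rw [h1, h2, comap_comap]
      rfl
    -- The limit defining `evalL2` identifies a value only if its filter is nontrivial, which is the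
    -- density of test functions in `L²(ℝ)`.
    have hne : (comap (fun u : 𝓢(ℝ, ℝ) => u.toLp 2 (volume : Measure ℝ))
        (𝓝 (hf.toLp f))).NeBot := by
      rw [comap_neBot_iff_frequently]
      exact mem_closure_iff_frequently.1 (hdense _)
    rw [evalL2, hcomap]
    refine Tendsto.limUnder_eq ?_
    simp_rw [← hJ']
    exact ((J.continuous.tendsto _).comp tendsto_comap)
  -- The identity of characteristic functions is a closed condition on `f`, so it need only be
  -- checked on test functions.
  · have hcl : IsClosed {f : Lp ℝ 2 (volume : Measure ℝ) | ∀ t : ℝ,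
        ∫ ω, Complex.exp (t * J f ω * Complex.I) ∂P
          = Complex.exp (-((χ * ‖f‖ ^ 2 : ℝ) * t ^ 2 / 2))} := by
      simp only [Set.ofPred_forall]
      refine isClosed_iInter fun t => isClosed_eq ?_ ?_
      · exact (continuous_integral_exp_mul_I t).comp J.continuous
      · fun_prop
    have hn : ∀ f : Lp ℝ 2 (volume : Measure ℝ), (((χ * ‖f‖ ^ 2).toNNReal : ℝ) : ℂ)
        = (χ * ‖f‖ ^ 2 : ℝ) := fun f => by
      rw [Real.coe_toNNReal _ (by positivity)]
    rw [hasLaw_gaussian_iff]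
    simp_rw [hn]
    refine hdense.induction_on (p := fun f => ∀ t : ℝ,
        ∫ ω, Complex.exp (t * J f ω * Complex.I) ∂P
          = Complex.exp (-((χ * ‖f‖ ^ 2 : ℝ) * t ^ 2 / 2))) f hcl fun u => ?_
    have h1 : HasLaw (J (u.toLp 2)) (gaussianReal 0 (χ * ‖u.toLp 2 (volume : Measure ℝ)‖ ^ 2).toNNReal)
        P := by
      rw [hJ', norm_sq_toLp]
      exact (hW u).congr (coeFn_classL2 (hW.memLp u))
    rw [hasLaw_gaussian_iff] at h1
    simpa only [hn] using h1

/-- The Wick square of the white noise `W`, evaluated at `f` in `L²(ℝ)`. -/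
def wickSq (P : Measure Ω) (χ : ℝ) (W : Ω → TemperedDist) (f : Lp ℝ 2 (volume : Measure ℝ)) :
    Lp ℝ 2 P :=
  classL2 P fun ω => evalL2 P W f ω ^ 2 - χ * ‖f‖ ^ 2

variable [IsProbabilityMeasure P]

theorem IsWhiteNoise.memLp_wickSq (hχ : 0 ≤ χ) (hW : IsWhiteNoise P χ W)
    (f : Lp ℝ 2 (volume : Measure ℝ)) :
    MemLp (fun ω => evalL2 P W f ω ^ 2 - χ * ‖f‖ ^ 2) 2 P := by
  obtain ⟨J, hJ, -, hJl⟩ := hW.exists_clm hχ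
  refine MemLp.sub ?_ (memLp_const _)
  rw [hJ f (Lp.memLp f), Lp.toLp_coeFn]
  have h4 := memLp_of_hasLaw_gaussian (hJl f) 4
  have := h4.norm_rpow_div (q := 2)
  have e : ((4 : NNReal) : ℝ≥0∞) / 2 = 2 := by
    rw [show ((4 : NNReal) : ℝ≥0∞) = 2 * 2 by norm_num,
      ENNReal.mul_div_cancel_right two_ne_zero ENNReal.ofNat_ne_top]
  rw [e] at this
  simpa using this

/-- By linearity of the extended noise, sums and differences of its values are Gaussian too, so
Isserlis' formula applies. Centring removes the product of the variances and leaves twice the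
squared covariance. -/
theorem IsWhiteNoise.inner_wickSq (hχ : 0 ≤ χ) (hW : IsWhiteNoise P χ W)
    (f g : Lp ℝ 2 (volume : Measure ℝ)) :
    inner ℝ (wickSq P χ W f) (wickSq P χ W g) = 2 * χ ^ 2 * (inner ℝ f g) ^ 2 := by
  obtain ⟨J, hJ, -, hJl⟩ := hW.exists_clm hχ
  have hJ' : ∀ f : Lp ℝ 2 (volume : Measure ℝ), evalL2 P W f = J f := fun f => by
    rw [hJ f (Lp.memLp f), Lp.toLp_coeFn]
  rw [wickSq, wickSq, inner_classL2 (hW.memLp_wickSq hχ f) (hW.memLp_wickSq hχ g), hJ', hJ']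
  have hp : HasLaw (fun ω => J f ω + J g ω) (gaussianReal 0 (χ * ‖f + g‖ ^ 2).toNNReal) P := by
    refine (hJl (f + g)).congr ?_
    rw [map_add]
    exact (Lp.coeFn_add _ _).symm
  have hq : HasLaw (fun ω => J f ω - J g ω) (gaussianReal 0 (χ * ‖f - g‖ ^ 2).toNNReal) P := by
    refine (hJl (f - g)).congr ?_
    rw [map_sub]
    exact (Lp.coeFn_sub _ _).symm
  have h22 := integral_sq_mul_sq_of_hasLaw (hJl f) (hJl g) hp hq
  have h2f := integral_sq_of_hasLaw (hJl f)
  have h2g := integral_sq_of_hasLaw (hJl g)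
  have hfi : Integrable (fun ω => J f ω ^ 2) P := (Lp.memLp _).integrable_sq
  have hgi : Integrable (fun ω => J g ω ^ 2) P := (Lp.memLp _).integrable_sq
  have hfg : Integrable (fun ω => J f ω ^ 2 * J g ω ^ 2) P := by
    have h1 := (hW.memLp_wickSq hχ f).add (memLp_const (χ * ‖f‖ ^ 2))
    have h2 := (hW.memLp_wickSq hχ g).add (memLp_const (χ * ‖g‖ ^ 2))
    have := h1.integrable_mul h2
    rw [hJ', hJ'] at this
    simpa [Pi.mul_def] using this
  have e : ∀ ω, (J f ω ^ 2 - χ * ‖f‖ ^ 2) * (J g ω ^ 2 - χ * ‖g‖ ^ 2)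
      = J f ω ^ 2 * J g ω ^ 2 - (χ * ‖f‖ ^ 2) * J g ω ^ 2 - (χ * ‖g‖ ^ 2) * J f ω ^ 2
        + (χ * ‖f‖ ^ 2) * (χ * ‖g‖ ^ 2) := fun ω => by ring
  simp_rw [e]
  have i1 : Integrable (fun ω => J f ω ^ 2 * J g ω ^ 2 - (χ * ‖f‖ ^ 2) * J g ω ^ 2) P :=
    hfg.sub (hgi.const_mul _)
  have i2 : Integrable (fun ω => J f ω ^ 2 * J g ω ^ 2 - (χ * ‖f‖ ^ 2) * J g ω ^ 2
      - (χ * ‖g‖ ^ 2) * J f ω ^ 2) P := i1.sub (hfi.const_mul _)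
  rw [integral_add i2 (integrable_const _), integral_sub i1 (hfi.const_mul _),
    integral_sub hfg (hgi.const_mul _), integral_const_mul, integral_const_mul, h22, h2f, h2g]
  have hn : ∀ h : Lp ℝ 2 (volume : Measure ℝ), ((χ * ‖h‖ ^ 2).toNNReal : ℝ) = χ * ‖h‖ ^ 2 :=
    fun h => Real.coe_toNNReal _ (by positivity)
  rw [hn, hn, hn, hn, norm_add_sq_real, norm_sub_sq_real]
  simp
  ring

/-- The covariance formula writes the squared norm of a difference as a continuous expression in
inner products, which vanishes on the diagonal. -/
theorem IsWhiteNoise.continuous_wickSq (hχ : 0 ≤ χ) (hW : IsWhiteNoise P χ W) :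
    Continuous (wickSq P χ W) := by
  have hn : ∀ f, ‖wickSq P χ W f‖ ^ 2 = 2 * χ ^ 2 * (‖f‖ ^ 2) ^ 2 := fun f => by
    rw [← real_inner_self_eq_norm_sq, hW.inner_wickSq hχ, real_inner_self_eq_norm_sq]
  refine continuous_iff_continuousAt.2 fun f => ?_
  rw [ContinuousAt, tendsto_iff_norm_sub_tendsto_zero]
  have h1 : ∀ g, ‖wickSq P χ W g - wickSq P χ W f‖ = √(2 * χ ^ 2 * (‖g‖ ^ 2) ^ 2
      - 2 * (2 * χ ^ 2 * (inner ℝ g f) ^ 2) + 2 * χ ^ 2 * (‖f‖ ^ 2) ^ 2) := by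
    intro g
    rw [← hn, ← hn, ← hW.inner_wickSq hχ, ← norm_sub_sq_real, Real.sqrt_sq (norm_nonneg _)]
  simp_rw [h1]
  have hc : Continuous fun g : Lp ℝ 2 (volume : Measure ℝ) => √(2 * χ ^ 2 * (‖g‖ ^ 2) ^ 2
      - 2 * (2 * χ ^ 2 * (inner ℝ g f) ^ 2) + 2 * χ ^ 2 * (‖f‖ ^ 2) ^ 2) := by fun_prop
  have := hc.tendsto f
  rw [real_inner_self_eq_norm_sq] at this
  convert this using 2
  rw [eq_comm, Real.sqrt_eq_zero']
  apply le_of_eq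
  ring

theorem IsWhiteNoise.wickSq_toLp (hχ : 0 ≤ χ) (hW : IsWhiteNoise P χ W) (u : 𝓢(ℝ, ℝ)) :
    wickSq P χ W (u.toLp 2) = classL2 P fun ω => W ω u ^ 2 - χ * ∫ x, u x ^ 2 := by
  obtain ⟨J, hJ, hJu, -⟩ := hW.exists_clm hχ
  refine classL2_congr ?_
  rw [hJ _ (Lp.memLp _), Lp.toLp_coeFn, hJu, norm_sq_toLp]
  filter_upwards [coeFn_classL2 (hW.memLp u)] with ω h
  rw [h]

/-- The inclusion of `L²(P)` in `L¹(P)`, for a probability measure `P`. -/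
def inclL1 (P : Measure Ω) [IsProbabilityMeasure P] : Lp ℝ 2 P →L[ℝ] Lp ℝ 1 P :=
  LinearMap.mkContinuous
    { toFun := fun f => ((Lp.memLp f).mono_exponent (by norm_num : (1 : ℝ≥0∞) ≤ 2)).toLp f
      map_add' := fun f g => by
        rw [← MemLp.toLp_add, MemLp.toLp_eq_toLp_iff]
        exact Lp.coeFn_add f g
      map_smul' := fun c f => by
        rw [RingHom.id_apply, ← MemLp.toLp_const_smul, MemLp.toLp_eq_toLp_iff]
        exact Lp.coeFn_smul c f } 1 fun f => by
      rw [one_mul, LinearMap.coe_mk, AddHom.coe_mk, Lp.norm_toLp, Lp.norm_def]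
      exact ENNReal.toReal_mono (Lp.eLpNorm_ne_top f)
        (eLpNorm_le_eLpNorm_of_exponent_le (by norm_num) (Lp.memLp f).aestronglyMeasurable)

theorem coeFn_inclL1 (f : Lp ℝ 2 P) : inclL1 P f =ᵐ[P] f :=
  MemLp.coeFn_toLp ((Lp.memLp f).mono_exponent (by norm_num : (1 : ℝ≥0∞) ≤ 2))

theorem IsWhiteNoise.sqL1_evalL2 (hχ : 0 ≤ χ) (hW : IsWhiteNoise P χ W)
    (f : Lp ℝ 2 (volume : Measure ℝ)) :
    sqL1 (evalL2 P W f) = inclL1 P (wickSq P χ W f + (χ * ‖f‖ ^ 2) • classL2 P 1) := by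
  refine Lp.ext ?_
  have h1 : MemLp (1 : Ω → ℝ) 2 P := memLp_const 1
  filter_upwards [Integrable.coeFn_toL1 (Lp.memLp (evalL2 P W f)).integrable_sq,
    coeFn_inclL1 (wickSq P χ W f + (χ * ‖f‖ ^ 2) • classL2 P 1),
    Lp.coeFn_add (wickSq P χ W f) ((χ * ‖f‖ ^ 2) • classL2 P 1),
    Lp.coeFn_smul (χ * ‖f‖ ^ 2) (classL2 P 1), coeFn_classL2 (hW.memLp_wickSq hχ f),
    coeFn_classL2 h1] with ω a1 a2 a3 a4 a5 a6
  rw [sqL1, a1, a2, a3, Pi.add_apply, a4, Pi.smul_apply, a6, wickSq, a5]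
  simp

/-- For test functions this is joint measurability of the process; continuity of the Wick square
extends it to `L²(ℝ)` by approximation. -/
theorem aestronglyMeasurable_wickSq {T : ℝ} {Y : ℝ → Ω → TemperedDist} (hχ : 0 ≤ χ)
    (hY : IsMeasurableProcess P T Y) (hS : ConditionS P T χ Y)
    (f : Lp ℝ 2 (volume : Measure ℝ)) :
    AEStronglyMeasurable (fun r => wickSq P χ (Y r) f) (volume.restrict (Set.Icc 0 T)) := by
  have hdense : DenseRange fun u : 𝓢(ℝ, ℝ) => u.toLp 2 (volume : Measure ℝ) :=
    SchwartzMap.denseRange_toLpCLM (F := ℝ) ENNReal.ofNat_ne_top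
  obtain ⟨s, hs, hsl⟩ := mem_closure_iff_seq_limit.1 (hdense f)
  choose u hu using hs
  refine aestronglyMeasurable_of_tendsto_ae atTop (f := fun n r =>
    classL2 P fun ω => Y r ω (u n) ^ 2 - χ * ∫ x, u n x ^ 2) (fun n => ?_) ?_
  · exact aestronglyMeasurable_classL2
      (f := fun p : ℝ × Ω => Y p.1 p.2 (u n) ^ 2 - χ * ∫ x, u n x ^ 2)
      (((hY (u n)).pow_const 2).sub_const _)
  · filter_upwards [ae_restrict_mem measurableSet_Icc] with r hr
    have h1 := (((hS r hr).continuous_wickSq hχ).tendsto f).comp hsl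
    refine h1.congr fun n => ?_
    rw [Function.comp_apply, ← hu n, (hS r hr).wickSq_toLp hχ]

end WhiteNoise

/-! ### The box functions in `L²(ℝ)`. -/

section Box

/-- The function `boxFn ε x`, as an element of `L²(ℝ)`. -/
def boxLp (ε x : ℝ) : Lp ℝ 2 (volume : Measure ℝ) :=
  indicatorConstLp 2 (measurableSet_Ioc (a := x) (b := x + ε)) (by simp) ε⁻¹

theorem boxLp_ae_eq (ε x : ℝ) : boxLp ε x =ᵐ[volume] boxFn ε x := indicatorConstLp_coeFn

theorem norm_sq_boxLp {ε : ℝ} (hε : 0 < ε) (x : ℝ) : ‖boxLp ε x‖ ^ 2 = ε⁻¹ := by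
  rw [boxLp, norm_indicatorConstLp two_ne_zero ENNReal.ofNat_ne_top, mul_pow, measureReal_def,
    Real.volume_Ioc, add_sub_cancel_left, ENNReal.toReal_ofReal hε.le, ← Real.rpow_natCast
    (ε ^ _), ← Real.rpow_mul hε.le]
  simp
  field_simp

theorem inner_boxLp_of_lt {ε x y : ℝ} (h : ε < |x - y|) :
    inner ℝ (boxLp ε x) (boxLp ε y) = 0 := by
  rw [L2.inner_def]
  refine integral_eq_zero_of_ae ?_
  filter_upwards [boxLp_ae_eq ε x, boxLp_ae_eq ε y] with z h1 h2
  rw [h1, h2, boxFn, boxFn]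
  by_cases hx : z ∈ Set.Ioc x (x + ε)
  · have hy : z ∉ Set.Ioc y (y + ε) := fun hy => by
      have : |x - y| ≤ ε := abs_le.2 ⟨by linarith [hx.1, hx.2, hy.1, hy.2],
        by linarith [hx.1, hx.2, hy.1, hy.2]⟩
      linarith
    simp [Set.indicator_of_notMem hy]
  · simp [Set.indicator_of_notMem hx]

theorem abs_inner_boxLp_le {ε : ℝ} (hε : 0 < ε) (x y : ℝ) :
    |inner ℝ (boxLp ε x) (boxLp ε y)| ≤ ε⁻¹ := by
  refine (abs_real_inner_le_norm _ _).trans ?_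
  have : ‖boxLp ε x‖ = ‖boxLp ε y‖ := by
    rw [← sq_eq_sq₀ (norm_nonneg _) (norm_nonneg _), norm_sq_boxLp hε, norm_sq_boxLp hε]
  rw [this, ← sq, norm_sq_boxLp hε]

theorem continuous_boxLp (ε : ℝ) : Continuous (boxLp ε) := by
  refine continuous_indicatorConstLp_set (by simp) fun x => ?_
  have hle : ∀ y : ℝ, volume (symmDiff (Set.Ioc y (y + ε)) (Set.Ioc x (x + ε)))
      ≤ ENNReal.ofReal (2 * |x - y|) := by
    intro y
    have hsub : symmDiff (Set.Ioc y (y + ε)) (Set.Ioc x (x + ε))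
        ⊆ Set.uIcc x y ∪ Set.uIcc (x + ε) (y + ε) := by
      intro z hz
      simp only [Set.mem_symmDiff, Set.mem_Ioc, Set.mem_union, Set.mem_uIcc] at hz ⊢
      grind
    refine (measure_mono hsub).trans ((measure_union_le _ _).trans ?_)
    rw [Real.volume_interval, Real.volume_interval, ← ENNReal.ofReal_add (abs_nonneg _) (abs_nonneg _)]
    refine ENNReal.ofReal_le_ofReal (le_of_eq ?_)
    rw [abs_sub_comm x y]
    ring_nf
  refine tendsto_of_tendsto_of_tendsto_of_le_of_le tendsto_const_nhds ?_ (fun _ => zero_le) hle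
  have : Continuous fun y => ENNReal.ofReal (2 * |x - y|) :=
    ENNReal.continuous_ofReal.comp (by fun_prop)
  simpa using this.tendsto x

end Box

/-! ### The spatial integral at a fixed time. -/

section SpatialTerm

theorem integrable_deriv (u : 𝓢(ℝ, ℝ)) : Integrable (deriv u) :=
  (SchwartzMap.derivCLM ℝ ℝ u).integrable

theorem continuous_deriv (u : 𝓢(ℝ, ℝ)) : Continuous (deriv u) :=
  (SchwartzMap.derivCLM ℝ ℝ u).continuous

theorem integral_deriv_eq_zero (u : 𝓢(ℝ, ℝ)) : ∫ x, deriv u x = 0 :=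
  integral_eq_zero_of_hasDerivAt_of_integrable (fun x => u.hasDerivAt x) (integrable_deriv u)
    u.integrable

theorem energy_eq (u : 𝓢(ℝ, ℝ)) :
    energy u = ‖(SchwartzMap.derivCLM ℝ ℝ u).toLp 2 (volume : Measure ℝ)‖ ^ 2 := by
  rw [norm_sq_toLp]
  rfl

theorem energy_nonneg (u : 𝓢(ℝ, ℝ)) : 0 ≤ energy u := by
  rw [energy_eq]; positivity

theorem lintegral_enorm_deriv_sq (u : 𝓢(ℝ, ℝ)) :
    ∫⁻ x, ‖deriv u x‖ₑ ^ 2 = ENNReal.ofReal (energy u) := by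
  have h : MemLp (deriv u) 2 volume := (SchwartzMap.derivCLM ℝ ℝ u).memLp 2 volume
  rw [energy, ofReal_integral_eq_lintegral_ofReal h.integrable_sq
    (ae_of_all _ fun x => sq_nonneg _)]
  refine lintegral_congr fun x => ?_
  rw [← ofReal_norm, ← ENNReal.ofReal_pow (norm_nonneg _), Real.norm_eq_abs, sq_abs]

/-- Schur's test for the kernel `1_{|x - y| ≤ ε}`. -/
theorem lintegral_mul_lintegral_Icc_le {f : ℝ → NNReal} (hf : Measurable f) (ε : ℝ) :
    ∫⁻ y, (f y : ℝ≥0∞) * ∫⁻ x in Set.Icc (y - ε) (y + ε), (f x : ℝ≥0∞)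
      ≤ ENNReal.ofReal (2 * ε) * ∫⁻ x, (f x : ℝ≥0∞) ^ 2 := by
  classical
  have hf' : Measurable fun x => (f x : ℝ≥0∞) := hf.coe_nnreal_ennreal
  let k : ℝ → ℝ → ℝ≥0∞ := fun x y => (Set.Icc (y - ε) (y + ε)).indicator 1 x
  have hksymm : ∀ x y, k x y = k y x := by
    intro x y
    have : x ∈ Set.Icc (y - ε) (y + ε) ↔ y ∈ Set.Icc (x - ε) (x + ε) := by
      simp only [Set.mem_Icc]; constructor <;> rintro ⟨_, _⟩ <;> constructor <;> linarith
    by_cases h : x ∈ Set.Icc (y - ε) (y + ε)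
    · simp only [k, Set.indicator_of_mem h, Set.indicator_of_mem (this.1 h)]; rfl
    · simp only [k, Set.indicator_of_notMem h, Set.indicator_of_notMem (fun h' => h (this.2 h'))]
  have hkm : Measurable (Function.uncurry k) := by
    have : Function.uncurry k = ({p : ℝ × ℝ | p.2 - ε ≤ p.1 ∧ p.1 ≤ p.2 + ε}).indicator 1 := by
      funext p
      by_cases h : p.2 - ε ≤ p.1 ∧ p.1 ≤ p.2 + ε <;>
        simp [k, Function.uncurry, Set.indicator, h]
    rw [this]
    have h1 : MeasurableSet {p : ℝ × ℝ | p.2 - ε ≤ p.1} :=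
      measurableSet_le (by fun_prop) (by fun_prop)
    have h2 : MeasurableSet {p : ℝ × ℝ | p.1 ≤ p.2 + ε} :=
      measurableSet_le (by fun_prop) (by fun_prop)
    exact measurable_one.indicator (h1.inter h2)
  have hk1 : ∀ y, ∫⁻ x, k x y = ENNReal.ofReal (2 * ε) := by
    intro y
    rw [lintegral_indicator_one measurableSet_Icc, Real.volume_Icc]
    ring_nf
  have hkmy : ∀ y, Measurable fun x => k x y := fun y => hkm.comp (by fun_prop :
    Measurable fun x : ℝ => (x, y))
  have hkmx : ∀ x, Measurable fun y => k x y := fun x => hkm.comp (by fun_prop :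
    Measurable fun y : ℝ => (x, y))
  have e1 : ∀ y, (f y : ℝ≥0∞) * ∫⁻ x in Set.Icc (y - ε) (y + ε), (f x : ℝ≥0∞)
      = ∫⁻ x, f y * f x * k x y := by
    intro y
    rw [← lintegral_indicator measurableSet_Icc, ← lintegral_const_mul _
      (hf'.indicator measurableSet_Icc)]
    refine lintegral_congr fun x => ?_
    by_cases h : x ∈ Set.Icc (y - ε) (y + ε)
    · simp only [k, Set.indicator_of_mem h, Pi.one_apply, mul_one]
    · simp only [k, Set.indicator_of_notMem h, mul_zero]
  -- The inequality `2ab ≤ a² + b²` reduces the bound to the marginal integrals of the symmetric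
  -- kernel, both equal to `2ε`.
  have e2 : ∀ x y, 2 * ((f y : ℝ≥0∞) * f x * k x y)
      ≤ (f y : ℝ≥0∞) ^ 2 * k x y + (f x : ℝ≥0∞) ^ 2 * k x y := by
    intro x y
    rw [← add_mul, ← mul_assoc, ← mul_assoc]
    gcongr
    exact_mod_cast two_mul_le_add_sq (f y) (f x)
  have h2 : 2 * ∫⁻ y, (f y : ℝ≥0∞) * ∫⁻ x in Set.Icc (y - ε) (y + ε), (f x : ℝ≥0∞)
      ≤ 2 * (ENNReal.ofReal (2 * ε) * ∫⁻ x, (f x : ℝ≥0∞) ^ 2) := by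
    calc 2 * ∫⁻ y, (f y : ℝ≥0∞) * ∫⁻ x in Set.Icc (y - ε) (y + ε), (f x : ℝ≥0∞)
        = ∫⁻ y, ∫⁻ x, 2 * (f y * f x * k x y) := by
          simp_rw [e1]
          rw [← lintegral_const_mul' _ _ (by simp)]
          simp_rw [lintegral_const_mul' (2 : ℝ≥0∞) _ (by simp)]
      _ ≤ ∫⁻ y, ∫⁻ x, ((f y : ℝ≥0∞) ^ 2 * k x y + (f x : ℝ≥0∞) ^ 2 * k x y) :=
          lintegral_mono fun y => lintegral_mono fun x => e2 x y
      _ = (∫⁻ y, ∫⁻ x, (f y : ℝ≥0∞) ^ 2 * k x y)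
            + ∫⁻ y, ∫⁻ x, (f x : ℝ≥0∞) ^ 2 * k x y := by
          rw [← lintegral_add_left]
          · exact lintegral_congr fun y => lintegral_add_left ((hkmy y).const_mul _) _
          · refine Measurable.lintegral_prod_right' (f := fun p : ℝ × ℝ =>
              (f p.1 : ℝ≥0∞) ^ 2 * k p.2 p.1) ?_
            exact ((hf'.comp measurable_fst).pow_const 2).mul (hkm.comp measurable_swap)
      _ = (∫⁻ y, ∫⁻ x, (f y : ℝ≥0∞) ^ 2 * k x y)
            + ∫⁻ x, ∫⁻ y, (f x : ℝ≥0∞) ^ 2 * k x y := by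
          congr 1
          refine lintegral_lintegral_swap (Measurable.aemeasurable ?_)
          exact ((hf'.comp measurable_snd).pow_const 2).mul (hkm.comp measurable_swap)
      _ = 2 * (ENNReal.ofReal (2 * ε) * ∫⁻ x, (f x : ℝ≥0∞) ^ 2) := by
          have a1 : ∀ y, ∫⁻ x, (f y : ℝ≥0∞) ^ 2 * k x y
              = ENNReal.ofReal (2 * ε) * (f y : ℝ≥0∞) ^ 2 := fun y => by
            rw [lintegral_const_mul _ (hkmy y), hk1, mul_comm]
          have a2 : ∀ x, ∫⁻ y, (f x : ℝ≥0∞) ^ 2 * k x y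
              = ENNReal.ofReal (2 * ε) * (f x : ℝ≥0∞) ^ 2 := fun x => by
            rw [lintegral_const_mul _ (hkmx x), lintegral_congr fun y => hksymm x y, hk1, mul_comm]
          simp_rw [a1, a2]
          rw [lintegral_const_mul' _ _ ENNReal.ofReal_ne_top]
          exact (two_mul _).symm
  exact (ENNReal.mul_le_mul_iff_right two_ne_zero ENNReal.ofNat_ne_top).1 h2

variable {Ω : Type*} [MeasurableSpace Ω] {P : Measure Ω} {χ : ℝ} {W : Ω → TemperedDist}

/-- The Wick square of the white noise `W`, regularized at scale `ε` and integrated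
against `∇u`. -/
def wickInt (P : Measure Ω) (χ : ℝ) (W : Ω → TemperedDist) (ε : ℝ) (u : 𝓢(ℝ, ℝ)) : Lp ℝ 2 P :=
  ∫ x, deriv u x • wickSq P χ W (boxLp ε x)

theorem wickInt_smul (ε c : ℝ) (u : 𝓢(ℝ, ℝ)) :
    wickInt P χ W ε (c • u) = c • wickInt P χ W ε u := by
  rw [wickInt, wickInt, ← integral_smul]
  refine integral_congr_ae (ae_of_all _ fun x => ?_)
  simp only
  rw [smul_smul]
  congr 1
  exact congrArg (fun w : 𝓢(ℝ, ℝ) => w x) (map_smul (SchwartzMap.derivCLM ℝ ℝ) c u)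

theorem evalL2_congr {f g : ℝ → ℝ} (h : f =ᵐ[volume] g) : evalL2 P W f = evalL2 P W g := by
  rw [evalL2, evalL2]
  congr 2
  funext u
  refine eLpNorm_congr_ae ?_
  filter_upwards [h] with y hy
  rw [hy]

variable [IsProbabilityMeasure P]

theorem IsWhiteNoise.norm_wickSq_boxLp (hχ : 0 ≤ χ) (hW : IsWhiteNoise P χ W) {ε : ℝ} (hε : 0 < ε)
    (x : ℝ) : ‖wickSq P χ W (boxLp ε x)‖ = √2 * (χ * ε⁻¹) := by
  rw [← sq_eq_sq₀ (norm_nonneg _) (by positivity), ← real_inner_self_eq_norm_sq,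
    hW.inner_wickSq hχ, real_inner_self_eq_norm_sq, norm_sq_boxLp hε, mul_pow,
    Real.sq_sqrt zero_le_two]
  ring

theorem IsWhiteNoise.continuous_wickSq_boxLp (hχ : 0 ≤ χ) (hW : IsWhiteNoise P χ W) (ε : ℝ) :
    Continuous fun x => wickSq P χ W (boxLp ε x) :=
  (hW.continuous_wickSq hχ).comp (continuous_boxLp ε)

theorem IsWhiteNoise.integrable_wickInt (hχ : 0 ≤ χ) (hW : IsWhiteNoise P χ W) {ε : ℝ} (hε : 0 < ε)
    (u : 𝓢(ℝ, ℝ)) : Integrable fun x => deriv u x • wickSq P χ W (boxLp ε x) := by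
  refine Integrable.mono' ((integrable_deriv u).norm.mul_const (√2 * (χ * ε⁻¹)))
    ((continuous_deriv u).smul (hW.continuous_wickSq_boxLp hχ ε)).aestronglyMeasurable
    (ae_of_all _ fun x => ?_)
  rw [norm_smul, hW.norm_wickSq_boxLp hχ hε]

/-- Expanding the square gives the kernel `2χ²⟨i_ε(x), i_ε(y)⟩²`, at most `2χ²ε⁻²` and supported in
`|x - y| ≤ ε`. Schur's test contributes the factor `2ε`. -/
theorem IsWhiteNoise.norm_sq_wickInt_le (hχ : 0 ≤ χ) (hW : IsWhiteNoise P χ W) {ε : ℝ} (hε : 0 < ε)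
    (u : 𝓢(ℝ, ℝ)) : ‖wickInt P χ W ε u‖ ^ 2 ≤ 4 * χ ^ 2 / ε * energy u := by
  set F := wickInt P χ W ε u with hF
  set c : ℝ := 2 * χ ^ 2 * (ε⁻¹) ^ 2 with hc
  have hint := hW.integrable_wickInt hχ hε u
  have h1 : ‖F‖ ^ 2 = ∫ y, deriv u y * inner ℝ F (wickSq P χ W (boxLp ε y)) := by
    rw [← real_inner_self_eq_norm_sq]
    nth_rewrite 2 [hF]
    rw [wickInt, ← integral_inner hint]
    simp_rw [real_inner_smul_right]
  have h2 : ∀ y, inner ℝ F (wickSq P χ W (boxLp ε y))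
      = ∫ x, deriv u x * (2 * χ ^ 2 * (inner ℝ (boxLp ε x) (boxLp ε y)) ^ 2) := by
    intro y
    rw [real_inner_comm, hF, wickInt, ← integral_inner hint]
    refine integral_congr_ae (ae_of_all _ fun x => ?_)
    simp only
    rw [real_inner_smul_right, hW.inner_wickSq hχ, real_inner_comm]
  have h3 : ∀ y, ‖inner ℝ F (wickSq P χ W (boxLp ε y))‖ₑ
      ≤ ENNReal.ofReal c * ∫⁻ x in Set.Icc (y - ε) (y + ε), (‖deriv u x‖₊ : ℝ≥0∞) := by
    intro y
    rw [h2, ← lintegral_indicator measurableSet_Icc, ← lintegral_const_mul' _ _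
      ENNReal.ofReal_ne_top]
    refine (enorm_integral_le_lintegral_enorm _).trans (lintegral_mono fun x => ?_)
    by_cases hx : x ∈ Set.Icc (y - ε) (y + ε)
    · rw [Set.indicator_of_mem hx, enorm_mul, mul_comm]
      gcongr
      · rw [← ofReal_norm]
        refine ENNReal.ofReal_le_ofReal ?_
        rw [Real.norm_of_nonneg (by positivity), hc]
        refine mul_le_mul_of_nonneg_left ?_ (by positivity)
        rw [sq_le_sq, abs_of_pos (inv_pos.2 hε)]
        exact abs_inner_boxLp_le hε x y
      · exact le_rfl
    · rw [Set.indicator_of_notMem hx, inner_boxLp_of_lt]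
      · simp
      · rw [lt_abs]
        simp only [Set.mem_Icc, not_and_or, not_le] at hx
        rcases hx with hx | hx
        · right; linarith
        · left; linarith
  have h4 : ENNReal.ofReal (‖F‖ ^ 2) ≤ ENNReal.ofReal (4 * χ ^ 2 / ε * energy u) := by
    calc ENNReal.ofReal (‖F‖ ^ 2) = ‖‖F‖ ^ 2‖ₑ := (Real.enorm_of_nonneg (by positivity)).symm
      _ ≤ ∫⁻ y, ‖deriv u y * inner ℝ F (wickSq P χ W (boxLp ε y))‖ₑ := by
          rw [h1]; exact enorm_integral_le_lintegral_enorm _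
      _ ≤ ∫⁻ y, ENNReal.ofReal c * ((‖deriv u y‖₊ : ℝ≥0∞)
            * ∫⁻ x in Set.Icc (y - ε) (y + ε), (‖deriv u x‖₊ : ℝ≥0∞)) := by
          refine lintegral_mono fun y => ?_
          rw [enorm_mul, mul_left_comm]
          exact mul_le_mul' le_rfl (h3 y)
      _ = ENNReal.ofReal c * ∫⁻ y, ((‖deriv u y‖₊ : ℝ≥0∞)
            * ∫⁻ x in Set.Icc (y - ε) (y + ε), (‖deriv u x‖₊ : ℝ≥0∞)) :=
          lintegral_const_mul' _ _ ENNReal.ofReal_ne_top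
      _ ≤ ENNReal.ofReal c * (ENNReal.ofReal (2 * ε) * ∫⁻ x, (‖deriv u x‖₊ : ℝ≥0∞) ^ 2) := by
          gcongr
          exact lintegral_mul_lintegral_Icc_le (continuous_deriv u).nnnorm.measurable ε
      _ = ENNReal.ofReal c * (ENNReal.ofReal (2 * ε) * ENNReal.ofReal (energy u)) := by
          rw [← lintegral_enorm_deriv_sq]; rfl
      _ = ENNReal.ofReal (4 * χ ^ 2 / ε * energy u) := by
          rw [← ENNReal.ofReal_mul (by positivity), ← ENNReal.ofReal_mul (by positivity), hc]
          congr 1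
          field_simp
          ring
  exact (ENNReal.ofReal_le_ofReal_iff (mul_nonneg (by positivity) (energy_nonneg u))).1 h4

theorem IsWhiteNoise.wickInt_add (hχ : 0 ≤ χ) (hW : IsWhiteNoise P χ W) {ε : ℝ} (hε : 0 < ε)
    (u v : 𝓢(ℝ, ℝ)) :
    wickInt P χ W ε (u + v) = wickInt P χ W ε u + wickInt P χ W ε v := by
  rw [wickInt, wickInt, wickInt, ← integral_add (hW.integrable_wickInt hχ hε u)
    (hW.integrable_wickInt hχ hε v)]
  refine integral_congr_ae (ae_of_all _ fun x => ?_)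
  simp only
  rw [← add_smul]
  congr 1
  exact congrArg (fun w : 𝓢(ℝ, ℝ) => w x) (map_add (SchwartzMap.derivCLM ℝ ℝ) u v)

/-- The divergent mean `χ/ε` of the square does not depend on `x`, so it disappears against `∇u`,
whose integral is zero. -/
theorem IsWhiteNoise.integral_sqL1 (hχ : 0 ≤ χ) (hW : IsWhiteNoise P χ W) {ε : ℝ} (hε : 0 < ε)
    (u : 𝓢(ℝ, ℝ)) :
    ∫ x, deriv u x • sqL1 (evalL2 P W (boxFn ε x)) = inclL1 P (wickInt P χ W ε u) := by
  have h1 : ∀ x, deriv u x • sqL1 (evalL2 P W (boxFn ε x))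
      = inclL1 P (deriv u x • wickSq P χ W (boxLp ε x))
        + deriv u x • inclL1 P ((χ * ε⁻¹) • classL2 P 1) := by
    intro x
    rw [← evalL2_congr (boxLp_ae_eq ε x), hW.sqL1_evalL2 hχ, norm_sq_boxLp hε]
    simp only [map_add, map_smul, smul_add]
  simp_rw [h1]
  have hint := hW.integrable_wickInt hχ hε u
  rw [integral_add ((inclL1 P).integrable_comp hint) ((integrable_deriv u).smul_const _),
    integral_smul_const, integral_deriv_eq_zero, zero_smul, add_zero,
    ContinuousLinearMap.integral_comp_comm _ hint, wickInt]

end SpatialTerm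

/-! ### The time integral and its two basic estimates. -/

section TimeIntegral

variable {Ω : Type*} [MeasurableSpace Ω] {P : Measure Ω} {χ T : ℝ} {Y : ℝ → Ω → TemperedDist}

/-- The regularized quadratic term, as an element of `L²(P)`. -/
def quadL2 (P : Measure Ω) (χ : ℝ) (Y : ℝ → Ω → TemperedDist) (ε s t : ℝ) (u : 𝓢(ℝ, ℝ)) :
    Lp ℝ 2 P :=
  ∫ r in s..t, wickInt P χ (Y r) ε u

theorem quadL2_smul (ε s t c : ℝ) (u : 𝓢(ℝ, ℝ)) :
    quadL2 P χ Y ε s t (c • u) = c • quadL2 P χ Y ε s t u := by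
  rw [quadL2, quadL2, ← intervalIntegral.integral_smul]
  exact intervalIntegral.integral_congr fun r _ => wickInt_smul ε c u

variable [IsProbabilityMeasure P]

theorem aestronglyMeasurable_wickInt (hχ : 0 ≤ χ) (hY : IsMeasurableProcess P T Y)
    (hS : ConditionS P T χ Y) (ε : ℝ) (u : 𝓢(ℝ, ℝ)) :
    AEStronglyMeasurable (fun r => wickInt P χ (Y r) ε u) (volume.restrict (Set.Icc 0 T)) := by
  refine AEStronglyMeasurable.integral_prod_right' (μ := volume.restrict (Set.Icc 0 T))
    (ν := volume) (f := Function.uncurry fun r x => deriv u x • wickSq P χ (Y r) (boxLp ε x)) ?_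
  refine aestronglyMeasurable_uncurry_of_continuous ?_ fun x => ?_
  · filter_upwards [ae_restrict_mem measurableSet_Icc] with r hr
    exact (continuous_deriv u).smul ((hS r hr).continuous_wickSq_boxLp hχ ε)
  · exact (aestronglyMeasurable_wickSq hχ hY hS (boxLp ε x)).const_smul (deriv u x)

theorem integrableOn_wickInt (hχ : 0 ≤ χ) (hY : IsMeasurableProcess P T Y)
    (hS : ConditionS P T χ Y) {ε : ℝ} (hε : 0 < ε) (u : 𝓢(ℝ, ℝ)) :
    IntegrableOn (fun r => wickInt P χ (Y r) ε u) (Set.Icc 0 T) := by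
  refine Integrable.of_bound (aestronglyMeasurable_wickInt hχ hY hS ε u)
    (√(4 * χ ^ 2 / ε * energy u)) ?_
  filter_upwards [ae_restrict_mem measurableSet_Icc] with r hr
  exact Real.le_sqrt_of_sq_le ((hS r hr).norm_sq_wickInt_le hχ hε u)

theorem intervalIntegrable_wickInt (hχ : 0 ≤ χ) (hY : IsMeasurableProcess P T Y)
    (hS : ConditionS P T χ Y) {ε : ℝ} (hε : 0 < ε) (u : 𝓢(ℝ, ℝ)) {s t : ℝ}
    (hs : s ∈ Set.Icc 0 T) (ht : t ∈ Set.Icc 0 T) :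
    IntervalIntegrable (fun r => wickInt P χ (Y r) ε u) volume s t := by
  refine IntegrableOn.intervalIntegrable ((integrableOn_wickInt hχ hY hS hε u).mono_set ?_)
  exact Set.ordConnected_Icc.uIcc_subset hs ht

/-- Bochner integrals commute with the inclusion of `L²(P)` in `L¹(P)`, so the rest of the argument
can take place in the Hilbert space `L²(P)`. -/
theorem quadTerm_eq (hχ : 0 ≤ χ) (hY : IsMeasurableProcess P T Y)
    (hS : ConditionS P T χ Y) {ε : ℝ} (hε : 0 < ε) (u : 𝓢(ℝ, ℝ)) {s t : ℝ}
    (hs : s ∈ Set.Icc 0 T) (ht : t ∈ Set.Icc 0 T) :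
    quadTerm P Y ε s t u = inclL1 P (quadL2 P χ Y ε s t u) := by
  rw [quadL2, ← ContinuousLinearMap.intervalIntegral_comp_comm _
    (intervalIntegrable_wickInt hχ hY hS hε u hs ht), quadTerm]
  refine intervalIntegral.integral_congr fun r hr => ?_
  exact (hS r (Set.ordConnected_Icc.uIcc_subset hs ht hr)).integral_sqL1 hχ hε u

theorem quadTerm_ae_eq (hχ : 0 ≤ χ) (hY : IsMeasurableProcess P T Y)
    (hS : ConditionS P T χ Y) {ε : ℝ} (hε : 0 < ε) (u : 𝓢(ℝ, ℝ)) {s t : ℝ}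
    (hs : s ∈ Set.Icc 0 T) (ht : t ∈ Set.Icc 0 T) :
    quadTerm P Y ε s t u =ᵐ[P] quadL2 P χ Y ε s t u := by
  rw [quadTerm_eq hχ hY hS hε u hs ht]
  exact coeFn_inclL1 _

theorem quadL2_add_adjacent (hχ : 0 ≤ χ) (hY : IsMeasurableProcess P T Y)
    (hS : ConditionS P T χ Y) {ε : ℝ} (hε : 0 < ε) (u : 𝓢(ℝ, ℝ)) {r s t : ℝ}
    (hr : r ∈ Set.Icc 0 T) (hs : s ∈ Set.Icc 0 T) (ht : t ∈ Set.Icc 0 T) :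
    quadL2 P χ Y ε r s u + quadL2 P χ Y ε s t u = quadL2 P χ Y ε r t u :=
  intervalIntegral.integral_add_adjacent_intervals
    (intervalIntegrable_wickInt hχ hY hS hε u hr hs)
    (intervalIntegrable_wickInt hχ hY hS hε u hs ht)

theorem quadL2_add (hχ : 0 ≤ χ) (hY : IsMeasurableProcess P T Y)
    (hS : ConditionS P T χ Y) {ε : ℝ} (hε : 0 < ε) (u v : 𝓢(ℝ, ℝ)) {s t : ℝ}
    (hs : s ∈ Set.Icc 0 T) (ht : t ∈ Set.Icc 0 T) :
    quadL2 P χ Y ε s t (u + v) = quadL2 P χ Y ε s t u + quadL2 P χ Y ε s t v := by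
  rw [quadL2, quadL2, quadL2, ← intervalIntegral.integral_add
    (intervalIntegrable_wickInt hχ hY hS hε u hs ht)
    (intervalIntegrable_wickInt hχ hY hS hε v hs ht)]
  refine intervalIntegral.integral_congr fun r hr => ?_
  exact (hS r (Set.ordConnected_Icc.uIcc_subset hs ht hr)).wickInt_add hχ hε u v

theorem norm_sq_quadL2_le (hχ : 0 ≤ χ) (hS : ConditionS P T χ Y) {ε : ℝ} (hε : 0 < ε)
    (u : 𝓢(ℝ, ℝ)) {s t : ℝ} (hs : s ∈ Set.Icc 0 T) (ht : t ∈ Set.Icc 0 T) :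
    ‖quadL2 P χ Y ε s t u‖ ^ 2 ≤ (t - s) ^ 2 * (4 * χ ^ 2 / ε * energy u) := by
  have h0 : 0 ≤ 4 * χ ^ 2 / ε * energy u := mul_nonneg (by positivity) (energy_nonneg u)
  have h1 : ‖quadL2 P χ Y ε s t u‖ ≤ √(4 * χ ^ 2 / ε * energy u) * |t - s| := by
    refine intervalIntegral.norm_integral_le_of_norm_le_const fun r hr => ?_
    have hr' : r ∈ Set.Icc 0 T :=
      Set.ordConnected_Icc.uIcc_subset hs ht (Set.uIoc_subset_uIcc hr)
    exact Real.le_sqrt_of_sq_le ((hS r hr').norm_sq_wickInt_le hχ hε u)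
  calc ‖quadL2 P χ Y ε s t u‖ ^ 2 ≤ (√(4 * χ ^ 2 / ε * energy u) * |t - s|) ^ 2 := by gcongr
    _ = _ := by rw [mul_pow, Real.sq_sqrt h0, sq_abs, mul_comm]

theorem norm_sq_quadL2_sub_le {κ : ℝ} (hχ : 0 ≤ χ) (hκ : 0 ≤ κ) (hY : IsMeasurableProcess P T Y)
    (hS : ConditionS P T χ Y) (hE : ConditionEC2 P T κ Y) (u : 𝓢(ℝ, ℝ)) {δ ε s t : ℝ} (hδ : 0 < δ)
    (hδε : δ ≤ ε) (hε : ε < 1) (hs : s ∈ Set.Icc 0 T) (ht : t ∈ Set.Icc 0 T) (hst : s ≤ t) :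
    ‖quadL2 P χ Y ε s t u - quadL2 P χ Y δ s t u‖ ^ 2 ≤ κ * (t - s) * ε * energy u := by
  have hε0 : 0 < ε := hδ.trans_le hδε
  have h0 : 0 ≤ κ * (t - s) * ε * energy u :=
    mul_nonneg (mul_nonneg (mul_nonneg hκ (sub_nonneg.2 hst)) hε0.le) (energy_nonneg u)
  rcases hδε.eq_or_lt with rfl | hδε
  · simpa using h0
  rcases hst.eq_or_lt with rfl | hst
  · simp [quadL2]
  have h := hE u δ ε hδ hδε hε s hs t ht hst
  have h1 : (fun ω => quadTerm P Y ε s t u ω - quadTerm P Y δ s t u ω)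
      =ᵐ[P] ⇑(quadL2 P χ Y ε s t u - quadL2 P χ Y δ s t u) := by
    filter_upwards [quadTerm_ae_eq hχ hY hS hε0 u hs ht, quadTerm_ae_eq hχ hY hS hδ u hs ht,
      Lp.coeFn_sub (quadL2 P χ Y ε s t u) (quadL2 P χ Y δ s t u)] with ω a b c
    rw [a, b, c, Pi.sub_apply]
  rw [meanSq_congr h1, meanSq_eq] at h
  exact (ENNReal.ofReal_le_ofReal_iff h0).1 h

end TimeIntegral

/-! ### Exponential kernels and the factorization of test functions. -/

section ExpKernel

/-- The function `x ↦ 1_{z < x} e^{z - x}`, the fundamental solution of `1 + ∇` with pole `z`. -/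
def expFn (z : ℝ) : ℝ → ℝ := (Set.Ioi z).indicator fun x => Real.exp (z - x)

theorem measurable_expFn (z : ℝ) : Measurable (expFn z) :=
  Measurable.indicator (by fun_prop) measurableSet_Ioi

theorem abs_expFn_le (z x : ℝ) : |expFn z x| ≤ 1 := by
  by_cases h : x ∈ Set.Ioi z
  · rw [expFn, Set.indicator_of_mem h, abs_of_pos (Real.exp_pos _), Real.exp_le_one_iff]
    linarith [Set.mem_Ioi.1 h]
  · rw [expFn, Set.indicator_of_notMem h]; simp

theorem expFn_mul_expFn (z y : ℝ) : (fun x => expFn z x * expFn y x)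
    = (Set.Ioi (max z y)).indicator fun x => Real.exp (z + y) * Real.exp (-2 * x) := by
  funext x
  by_cases hz : z < x <;> by_cases hy : y < x
  · rw [expFn, expFn, Set.indicator_of_mem (Set.mem_Ioi.2 hz), Set.indicator_of_mem
      (Set.mem_Ioi.2 hy), Set.indicator_of_mem (Set.mem_Ioi.2 (max_lt hz hy)), ← Real.exp_add,
      ← Real.exp_add]
    congr 1
    ring
  all_goals simp [expFn, Set.indicator, hz, hy]

theorem integrable_expFn_mul_expFn (z y : ℝ) : Integrable fun x => expFn z x * expFn y x := by
  rw [expFn_mul_expFn, integrable_indicator_iff measurableSet_Ioi]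
  exact (integrableOn_exp_mul_Ioi (by norm_num) _).const_mul _

theorem integral_expFn_mul_expFn (z y : ℝ) :
    ∫ x, expFn z x * expFn y x = Real.exp (-|z - y|) / 2 := by
  rw [expFn_mul_expFn, integral_indicator measurableSet_Ioi, integral_const_mul,
    integral_exp_mul_Ioi (by norm_num)]
  have : Real.exp (-|z - y|) = Real.exp (z + y) * Real.exp (-2 * max z y) := by
    rw [← Real.exp_add]
    congr 1
    rcases le_total z y with h | h
    · rw [max_eq_right h, abs_of_nonpos (by linarith)]; ring
    · rw [max_eq_left h, abs_of_nonneg (by linarith)]; ring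
  rw [this]
  ring

theorem memLp_expFn (z : ℝ) : MemLp (expFn z) 2 volume := by
  rw [memLp_two_iff_integrable_sq (measurable_expFn z).aestronglyMeasurable]
  simpa only [sq] using integrable_expFn_mul_expFn z z

/-- The function `expFn z`, as an element of `L²(ℝ)`. -/
def expLp (z : ℝ) : Lp ℝ 2 (volume : Measure ℝ) := (memLp_expFn z).toLp _

theorem expLp_ae_eq (z : ℝ) : expLp z =ᵐ[volume] expFn z := MemLp.coeFn_toLp _

theorem inner_expLp (z y : ℝ) : inner ℝ (expLp z) (expLp y) = Real.exp (-|z - y|) / 2 := by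
  rw [← integral_expFn_mul_expFn, L2.inner_def]
  refine integral_congr_ae ?_
  filter_upwards [expLp_ae_eq z, expLp_ae_eq y] with x h1 h2
  rw [h1, h2]
  simp [mul_comm]

theorem norm_expLp_le (z : ℝ) : ‖expLp z‖ ≤ 1 := by
  have : ‖expLp z‖ ^ 2 = 1 / 2 := by
    rw [← real_inner_self_eq_norm_sq, inner_expLp]; simp
  nlinarith [norm_nonneg (expLp z)]

theorem continuous_expLp : Continuous expLp := by
  refine continuous_iff_continuousAt.2 fun y => ?_
  rw [ContinuousAt, tendsto_iff_norm_sub_tendsto_zero]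
  have h1 : ∀ z, ‖expLp z - expLp y‖ = √(1 - Real.exp (-|z - y|)) := by
    intro z
    rw [← Real.sqrt_sq (norm_nonneg (expLp z - expLp y)), norm_sub_sq_real,
      ← real_inner_self_eq_norm_sq, ← real_inner_self_eq_norm_sq, inner_expLp, inner_expLp,
      inner_expLp]
    congr 1
    simp
    ring
  simp_rw [h1]
  have hc : Continuous fun z => √(1 - Real.exp (-|z - y|)) := by fun_prop
  simpa using hc.tendsto y

theorem integrable_exp_mul_Ioi (w : 𝓢(ℝ, ℝ)) (z : ℝ) :
    IntegrableOn (fun x => Real.exp (z - x) * w x) (Set.Ioi z) := by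
  refine Integrable.mono' (w.integrable (μ := volume)).norm.integrableOn
    (by fun_prop) ?_
  filter_upwards [ae_restrict_mem measurableSet_Ioi] with x hx
  rw [norm_mul, Real.norm_of_nonneg (Real.exp_pos _).le]
  refine mul_le_of_le_one_left (norm_nonneg _) ?_
  rw [Real.exp_le_one_iff]
  linarith [Set.mem_Ioi.1 hx]

theorem inner_expLp_toLp (w : 𝓢(ℝ, ℝ)) (z : ℝ) :
    inner ℝ (expLp z) (w.toLp 2) = ∫ x in Set.Ioi z, Real.exp (z - x) * w x := by
  rw [← integral_indicator measurableSet_Ioi, L2.inner_def]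
  refine integral_congr_ae ?_
  filter_upwards [expLp_ae_eq z, w.coeFn_toLp 2 volume] with x h1 h2
  rw [h1, h2]
  by_cases hx : x ∈ Set.Ioi z
  · simp [expFn, Set.indicator_of_mem hx, mul_comm]
  · simp [expFn, Set.indicator_of_notMem hx]

/-- The kernel `expLp z` represents the evaluation at `z` composed with `(1 - ∇)⁻¹`. -/
theorem inner_expLp_sub_deriv (w : 𝓢(ℝ, ℝ)) (z : ℝ) :
    inner ℝ (expLp z) ((w - SchwartzMap.derivCLM ℝ ℝ w).toLp 2) = w z := by
  rw [inner_expLp_toLp]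
  have hd : ∀ x ∈ Set.Ici z, HasDerivAt (fun x => -(Real.exp (z - x) * w x))
      (Real.exp (z - x) * (w - SchwartzMap.derivCLM ℝ ℝ w) x) x := by
    intro x _
    have h1 : HasDerivAt (fun x => Real.exp (z - x)) (-Real.exp (z - x)) x := by
      simpa using ((hasDerivAt_id x).const_sub z).exp
    convert! (h1.mul (w.hasDerivAt x)).neg using 1
    rw [sub_apply, SchwartzMap.derivCLM_apply]
    ring
  have ht : Tendsto (fun x => -(Real.exp (z - x) * w x)) atTop (𝓝 0) := by
    have h1 : Tendsto w atTop (𝓝 0) :=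
      w.tendsto_cocompact.mono_left atTop_le_cocompact
    have h2 : Tendsto (fun x => Real.exp (z - x)) atTop (𝓝 0) :=
      Real.tendsto_exp_atBot.comp (tendsto_atBot_add_const_left _ z tendsto_neg_atTop_atBot)
    simpa using (h2.mul h1).neg
  rw [integral_Ioi_of_hasDerivAt_of_tendsto' hd (integrable_exp_mul_Ioi _ z) ht]
  simp

theorem integral_Iio_exp_mul_add_deriv (v : 𝓢(ℝ, ℝ)) (x : ℝ) :
    ∫ z in Set.Iic x, Real.exp (z - x) * (v + SchwartzMap.derivCLM ℝ ℝ v) z = v x := by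
  have hd : ∀ z ∈ Set.Iic x, HasDerivAt (fun z => Real.exp (z - x) * v z)
      (Real.exp (z - x) * (v + SchwartzMap.derivCLM ℝ ℝ v) z) z := by
    intro z _
    have h1 : HasDerivAt (fun z => Real.exp (z - x)) (Real.exp (z - x)) z := by
      simpa using ((hasDerivAt_id z).sub_const x).exp
    convert! h1.mul (v.hasDerivAt z) using 1
    rw [add_apply, SchwartzMap.derivCLM_apply]
    ring
  have ht : Tendsto (fun z => Real.exp (z - x) * v z) atBot (𝓝 0) := by
    have h1 : Tendsto v atBot (𝓝 0) :=
      v.tendsto_cocompact.mono_left atBot_le_cocompact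
    have h2 : Tendsto (fun z => Real.exp (z - x)) atBot (𝓝 0) :=
      Real.tendsto_exp_atBot.comp (tendsto_atBot_add_const_right _ (-x) tendsto_id)
    simpa using h2.mul h1
  rw [integral_Iic_of_hasDerivAt_of_tendsto' hd ?_ ht]
  · simp
  · refine Integrable.mono' ((v + SchwartzMap.derivCLM ℝ ℝ v).integrable
      (μ := volume)).norm.integrableOn (by fun_prop) ?_
    filter_upwards [ae_restrict_mem measurableSet_Iic] with z hz
    rw [norm_mul, Real.norm_of_nonneg (Real.exp_pos _).le]
    refine mul_le_of_le_one_left (norm_nonneg _) ?_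
    rw [Real.exp_le_one_iff]
    linarith [Set.mem_Iic.1 hz]

theorem integrable_smul_expLp (p : 𝓢(ℝ, ℝ)) : Integrable fun z => p z • expLp z := by
  refine Integrable.mono' p.integrable.norm
    (p.continuous.smul continuous_expLp).aestronglyMeasurable (ae_of_all _ fun z => ?_)
  rw [norm_smul]
  exact mul_le_of_le_one_right (norm_nonneg _) (norm_expLp_le z)

/-- The representation `v = ∫ (v + ∇v)(z) expLp z dz` of a test function in `L²(ℝ)`. -/
theorem integral_smul_expLp (v : 𝓢(ℝ, ℝ)) :
    ∫ z, (v + SchwartzMap.derivCLM ℝ ℝ v) z • expLp z = v.toLp 2 := by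
  set p := v + SchwartzMap.derivCLM ℝ ℝ v with hp
  -- The identity is tested against a dense set of `w`. After Fubini the inner integral is `∫_{z<x}
  -- e^{z-x}(v + ∇v)(z) dz = v(x)`.
  have key : ∀ w : 𝓢(ℝ, ℝ), inner ℝ (w.toLp 2 (volume : Measure ℝ)) (∫ z, p z • expLp z)
      = inner ℝ (w.toLp 2 (volume : Measure ℝ)) (v.toLp 2) := by
    intro w
    have hF : Integrable (Function.uncurry fun z x => p z * (expFn z x * w x))
        (volume.prod volume) := by
      refine Integrable.mono' ((p.integrable (μ := volume)).norm.mul_prod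
        (w.integrable (μ := volume)).norm) ?_ (ae_of_all _ fun q => ?_)
      · refine Measurable.aestronglyMeasurable ?_
        have h1 : Measurable fun q : ℝ × ℝ => expFn q.1 q.2 := by
          have : (fun q : ℝ × ℝ => expFn q.1 q.2)
              = ({q : ℝ × ℝ | q.1 < q.2}).indicator fun q => Real.exp (q.1 - q.2) := by
            funext q
            by_cases h : q.1 < q.2 <;> simp [expFn, Set.indicator, h]
          rw [this]
          exact Measurable.indicator (by fun_prop) (measurableSet_lt measurable_fst measurable_snd)
        exact (p.continuous.measurable.comp measurable_fst).mul
          (h1.mul (w.continuous.measurable.comp measurable_snd))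
      · simp only [Function.uncurry, norm_mul]
        refine mul_le_mul_of_nonneg_left ?_ (norm_nonneg _)
        exact mul_le_of_le_one_left (norm_nonneg _) (abs_expFn_le _ _)
    rw [← integral_inner (integrable_smul_expLp p)]
    have e1 : ∀ z, inner ℝ (w.toLp 2 (volume : Measure ℝ)) (p z • expLp z)
        = ∫ x, p z * (expFn z x * w x) := by
      intro z
      rw [real_inner_smul_right, real_inner_comm, inner_expLp_toLp, integral_const_mul,
        ← integral_indicator measurableSet_Ioi]
      congr 2
      funext x
      by_cases hx : x ∈ Set.Ioi z
      · simp only [expFn, Set.indicator_of_mem hx]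
      · simp [expFn, Set.indicator_of_notMem hx]
    simp_rw [e1]
    rw [integral_integral_swap hF, L2.inner_def]
    refine integral_congr_ae ?_
    filter_upwards [w.coeFn_toLp 2 volume, v.coeFn_toLp 2 volume] with x h1 h2
    rw [h1, h2]
    have e2 : ∀ z, p z * (expFn z x * w x)
        = w x * (Set.Iio x).indicator (fun z => Real.exp (z - x) * p z) z := by
      intro z
      by_cases hx : z < x
      · rw [Set.indicator_of_mem (Set.mem_Iio.2 hx), expFn, Set.indicator_of_mem (Set.mem_Ioi.2 hx)]
        ring
      · rw [Set.indicator_of_notMem (fun h => hx (Set.mem_Iio.1 h)), expFn,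
          Set.indicator_of_notMem (fun h => hx (Set.mem_Ioi.1 h))]
        ring
    simp_rw [e2]
    rw [integral_const_mul, integral_indicator measurableSet_Iio, ← integral_Iic_eq_integral_Iio,
      hp, integral_Iio_exp_mul_add_deriv]
    simp [mul_comm]
  have hdense : DenseRange fun u : 𝓢(ℝ, ℝ) => u.toLp 2 (volume : Measure ℝ) :=
    SchwartzMap.denseRange_toLpCLM (F := ℝ) ENNReal.ofNat_ne_top
  refine ext_inner_left ℝ fun f => ?_
  exact hdense.induction_on (p := fun f => inner ℝ f (∫ z, p z • expLp z)
    = inner ℝ f (v.toLp 2 (volume : Measure ℝ))) f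
    (isClosed_eq (by fun_prop) (by fun_prop)) key

/-- The operator `u ↦ (1 - ∇) (1 + x²) (1 + ∇) ∇ u` on test functions. -/
def weightedDeriv : 𝓢(ℝ, ℝ) →L[ℝ] 𝓢(ℝ, ℝ) :=
  (ContinuousLinearMap.id ℝ _ - SchwartzMap.derivCLM ℝ ℝ).comp
    ((SchwartzMap.smulLeftCLM ℝ fun x : ℝ => 1 + x ^ 2).comp
      ((ContinuousLinearMap.id ℝ _ + SchwartzMap.derivCLM ℝ ℝ).comp (SchwartzMap.derivCLM ℝ ℝ)))

/-- Pairing with `expLp z` inverts the factor `1 - ∇`, and the weight cancels `1 + x²` at `z`. What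
remains is the coefficient with which `integral_smul_expLp` reconstructs `∇u`. -/
theorem inner_expLp_weightedDeriv (u : 𝓢(ℝ, ℝ)) (z : ℝ) :
    inner ℝ ((1 + z ^ 2)⁻¹ • expLp z) ((weightedDeriv u).toLp 2)
      = (SchwartzMap.derivCLM ℝ ℝ u
        + SchwartzMap.derivCLM ℝ ℝ (SchwartzMap.derivCLM ℝ ℝ u)) z := by
  have hg : Function.HasTemperateGrowth fun x : ℝ => 1 + x ^ 2 := by
    fun_prop
  have h := inner_expLp_sub_deriv (SchwartzMap.smulLeftCLM ℝ (fun x : ℝ => 1 + x ^ 2)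
    (SchwartzMap.derivCLM ℝ ℝ u + SchwartzMap.derivCLM ℝ ℝ (SchwartzMap.derivCLM ℝ ℝ u))) z
  rw [real_inner_smul_left]
  have e : inner ℝ (expLp z) ((weightedDeriv u).toLp 2 (volume : Measure ℝ))
      = (1 + z ^ 2) * (SchwartzMap.derivCLM ℝ ℝ u
        + SchwartzMap.derivCLM ℝ ℝ (SchwartzMap.derivCLM ℝ ℝ u)) z := by
    refine Eq.trans h ?_
    rw [SchwartzMap.smulLeftCLM_apply_apply hg, smul_eq_mul]
  rw [e, inv_mul_cancel_left₀ (by positivity)]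

end ExpKernel

/-! ### From Hölder bounds to a continuous process of distributions. -/

section DistributionProcess

variable {K : Type*} [TopologicalSpace K] [CompactSpace K] {E : Type*} [NormedAddCommGroup E]
  [NormedSpace ℝ E]

/-- The bilinear map `(x, f) ↦ (t ↦ f t • x)`, from `E × C(K, ℝ)` to `C(K, E)`. -/
def tensorCLM (K E : Type*) [TopologicalSpace K] [CompactSpace K] [NormedAddCommGroup E]
    [NormedSpace ℝ E] : E →L[ℝ] C(K, ℝ) →L[ℝ] C(K, E) :=
  LinearMap.mkContinuous₂
    (LinearMap.mk₂ ℝ (fun (x : E) (f : C(K, ℝ)) => ⟨fun t => f t • x, by fun_prop⟩)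
      (fun x y f => by ext t; simp) (fun c x f => by ext t; exact smul_comm _ _ _)
      (fun x f g => by ext t; simp [add_smul]) (fun c x f => by ext t; simp [mul_smul])) 1
    fun x f => by
      rw [one_mul]
      refine (ContinuousMap.norm_le _ (by positivity)).2 fun t => ?_
      rw [LinearMap.mk₂_apply, ContinuousMap.coe_mk, norm_smul, mul_comm]
      exact mul_le_mul_of_nonneg_left (f.norm_coe_le_norm t) (norm_nonneg x)

theorem norm_tensorCLM_le (x : E) : ‖tensorCLM K E x‖ ≤ ‖x‖ := by
  refine ContinuousLinearMap.opNorm_le_bound _ (norm_nonneg x) fun f => ?_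
  refine (ContinuousMap.norm_le _ (by positivity)).2 fun t => ?_
  have h : tensorCLM K E x f t = f t • x := rfl
  rw [h, norm_smul, mul_comm]
  exact mul_le_mul_of_nonneg_left (f.norm_coe_le_norm t) (norm_nonneg x)

variable {Ω : Type*} [MeasurableSpace Ω] {P : Measure Ω}

/-- The random path `∫ L(g z) ⊗ ψ z dz` with values in a Hilbert space `H`, for a continuous linear
map `L` from `H` to the square integrable random real paths. -/
theorem exists_path_of_clm {H : Type*} [NormedAddCommGroup H] [InnerProductSpace ℝ H]
    [CompleteSpace H] {T : ℝ} (L : H →L[ℝ] Lp C(Set.Icc (0 : ℝ) T, ℝ) 2 P) {g ψ : ℝ → H}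
    (hg : Continuous g) (hψ : Continuous ψ) (hg1 : ∀ z, ‖g z‖ ≤ 1)
    (hψ1 : ∀ z, ‖ψ z‖ ≤ (1 + z ^ 2)⁻¹) :
    ∃ V : Lp C(Set.Icc (0 : ℝ) T, H) 2 P, ∀ (d : H) (t : Set.Icc (0 : ℝ) T),
      (fun ω => inner ℝ d (V ω t)) =ᵐ[P] evalLp P t (L (∫ z, inner ℝ d (ψ z) • g z)) := by
  let B := (tensorCLM (Set.Icc (0 : ℝ) T) H).compLpL₂ 2 P
  -- The decay `(1 + z²)⁻¹` of `ψ` is what makes the vector-valued integral converge absolutely.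
  have hint : Integrable fun z => B (ψ z) (L (g z)) := by
    refine Integrable.mono' (integrable_inv_one_add_sq.mul_const ‖L‖)
      ((B.continuous.comp hψ).clm_apply (L.continuous.comp hg)).aestronglyMeasurable
      (ae_of_all _ fun z => ?_)
    have h2 : ‖L (g z)‖ ≤ ‖L‖ :=
      (L.le_opNorm _).trans (mul_le_of_le_one_right (norm_nonneg _) (hg1 z))
    calc ‖B (ψ z) (L (g z))‖ ≤ ‖tensorCLM (Set.Icc (0 : ℝ) T) H (ψ z)‖ * ‖L (g z)‖ :=
          ContinuousLinearMap.norm_compLp_le _ _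
      _ ≤ (1 + z ^ 2)⁻¹ * ‖L‖ := by
          gcongr
          exact (norm_tensorCLM_le _).trans (hψ1 z)
  refine ⟨∫ z, B (ψ z) (L (g z)), fun d t => ?_⟩
  have hint' : Integrable fun z => inner ℝ d (ψ z) • g z := by
    refine Integrable.mono' (integrable_inv_one_add_sq.const_mul ‖d‖)
      ((continuous_const.inner hψ).smul hg).aestronglyMeasurable (ae_of_all _ fun z => ?_)
    rw [norm_smul]
    calc ‖inner ℝ d (ψ z)‖ * ‖g z‖ ≤ ‖d‖ * ‖ψ z‖ * 1 := by
          gcongr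
          · exact norm_inner_le_norm _ _
          · exact hg1 z
      _ ≤ ‖d‖ * (1 + z ^ 2)⁻¹ := by rw [mul_one]; gcongr; exact hψ1 z
  let Θ : C(Set.Icc (0 : ℝ) T, H) →L[ℝ] ℝ := (innerSL ℝ d).comp (ContinuousMap.evalCLM ℝ t)
  have h1 : ∀ z, Θ.compLpL 2 P (B (ψ z) (L (g z)))
      = ((evalLp P t).comp L) (inner ℝ d (ψ z) • g z) := by
    intro z
    rw [map_smul]
    refine Lp.ext ?_
    filter_upwards [Θ.coeFn_compLpL (p := 2) (μ := P) (B (ψ z) (L (g z))),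
      (tensorCLM (Set.Icc (0 : ℝ) T) H (ψ z)).coeFn_compLpL (p := 2) (μ := P) (L (g z)),
      (ContinuousMap.evalCLM ℝ t : C(Set.Icc (0 : ℝ) T, ℝ) →L[ℝ] ℝ).coeFn_compLpL (p := 2) (μ := P)
        (L (g z)),
      Lp.coeFn_smul (inner ℝ d (ψ z)) (((evalLp P t).comp L) (g z))] with ω e1 e2 e3 e4
    have e2' : B (ψ z) (L (g z)) ω = tensorCLM (Set.Icc (0 : ℝ) T) H (ψ z) (L (g z) ω) := e2
    have e3' : ((evalLp P t).comp L) (g z) ω = L (g z) ω t := e3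
    have e5 : Θ (tensorCLM (Set.Icc (0 : ℝ) T) H (ψ z) (L (g z) ω))
        = inner ℝ d (L (g z) ω t • ψ z) := rfl
    rw [e1, e4, e2', Pi.smul_apply, e3', e5, real_inner_smul_right, smul_eq_mul, mul_comm]
  have hΘ : Θ.compLpL 2 P (∫ z, B (ψ z) (L (g z)))
      = evalLp P t (L (∫ z, inner ℝ d (ψ z) • g z)) := by
    rw [← ContinuousLinearMap.integral_comp_comm _ hint]
    simp_rw [h1]
    rw [ContinuousLinearMap.integral_comp_comm _ hint']
    rfl
  rw [← hΘ]
  exact (Θ.coeFn_compLpL (p := 2) (μ := P) _).symm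

/-- Kolmogorov's bound is linear in the Hölder constant, here `M‖∇u‖`, and continuous versions are
unique. Hence the version is linear in `u`, is bounded by `‖∇u‖`, and factors through the gradient.
-/
theorem exists_clm_paths {T M : ℝ} (hT : 0 < T) (hM : 0 ≤ M)
    (a : Set.Icc (0 : ℝ) T → 𝓢(ℝ, ℝ) →ₗ[ℝ] Lp ℝ 2 P) (h0 : ∀ u, a ⟨0, le_rfl, hT.le⟩ u = 0)
    (ha : ∀ u s t, ‖a t u - a s u‖ ^ 2 ≤ M ^ 2 * |(t : ℝ) - s| ^ (3 / 2 : ℝ) * energy u) :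
    ∃ L : Lp ℝ 2 (volume : Measure ℝ) →L[ℝ] Lp C(Set.Icc (0 : ℝ) T, ℝ) 2 P,
      ∀ u t, evalLp P t (L ((SchwartzMap.derivCLM ℝ ℝ u).toLp 2)) = a t u := by
  obtain ⟨C, hC, hkol⟩ := exists_continuous_version hT
  let D₀ := (SchwartzMap.toLpCLM ℝ ℝ 2 (volume : Measure ℝ)).comp (SchwartzMap.derivCLM ℝ ℝ)
  have hD₀ : ∀ u, energy u = ‖D₀ u‖ ^ 2 := energy_eq
  have hex : ∀ u, ∃ X : Lp C(Set.Icc (0 : ℝ) T, ℝ) 2 P,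
      (∀ t, evalLp P t X = a t u) ∧ ‖X‖ ≤ C * (M * ‖D₀ u‖) := by
    intro u
    obtain ⟨X, hX, hXn⟩ := hkol (fun t => a (Set.projIcc 0 T hT.le t) u) (M := M * ‖D₀ u‖)
      (by positivity) (by rw [Set.projIcc_left, h0]) (fun s hs t ht => by
        rw [Set.projIcc_of_mem hT.le hs, Set.projIcc_of_mem hT.le ht, mul_pow, ← hD₀]
        refine (ha u ⟨s, hs⟩ ⟨t, ht⟩).trans (le_of_eq ?_)
        ring)
    exact ⟨X, fun t => by rw [hX t, Set.projIcc_val], hXn⟩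
  choose X hX hXn using hex
  let l : 𝓢(ℝ, ℝ) →ₗ[ℝ] Lp C(Set.Icc (0 : ℝ) T, ℝ) 2 P :=
    { toFun := X
      map_add' := fun u v => ext_evalLp hT.le fun t => by simp only [map_add, hX]
      map_smul' := fun c u => ext_evalLp hT.le fun t => by
        simp only [map_smul, hX, RingHom.id_apply] }
  obtain ⟨L, hL⟩ := exists_clm_comp_eq D₀.toLinearMap l (C * M) fun u => by
    rw [mul_assoc]; exact hXn u
  refine ⟨L, fun u t => ?_⟩
  have h2 : L ((SchwartzMap.derivCLM ℝ ℝ u).toLp 2 (volume : Measure ℝ)) = X u := hL u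
  rw [h2, hX]

/-- A process with values in the linear maps from `S(ℝ)` to `L²(P)`, with Hölder continuous
increments in terms of the energy, has a version with values in `S'(ℝ)` and continuous paths. -/
theorem exists_distribution_process {T M : ℝ} (hT : 0 < T) (hM : 0 ≤ M)
    (a : Set.Icc (0 : ℝ) T → 𝓢(ℝ, ℝ) →ₗ[ℝ] Lp ℝ 2 P) (h0 : ∀ u, a ⟨0, le_rfl, hT.le⟩ u = 0)
    (ha : ∀ u s t, ‖a t u - a s u‖ ^ 2 ≤ M ^ 2 * |(t : ℝ) - s| ^ (3 / 2 : ℝ) * energy u) :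
    ∃ A : ℝ → Ω → TemperedDist, (∀ t u, Measurable fun ω => A t ω u) ∧
      (∀ ω, Continuous fun t => A t ω) ∧
      ∀ (t : Set.Icc (0 : ℝ) T) u, (fun ω => A t ω u) =ᵐ[P] a t u := by
  obtain ⟨L, hL⟩ := exists_clm_paths hT hM a h0 ha
  have hψ : Continuous fun z : ℝ => (1 + z ^ 2)⁻¹ • expLp z := by
    have h1 : Continuous fun z : ℝ => (1 + z ^ 2)⁻¹ :=
      Continuous.inv₀ (by fun_prop) fun z => by positivity
    exact h1.smul continuous_expLp
  obtain ⟨V, hV⟩ := exists_path_of_clm L continuous_expLp hψ norm_expLp_le fun z => by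
    rw [norm_smul, Real.norm_of_nonneg (by positivity)]
    exact mul_le_of_le_one_right (by positivity) (norm_expLp_le z)
  let D := (SchwartzMap.toLpCLM ℝ ℝ 2 (volume : Measure ℝ)).comp weightedDeriv
  let Λ : Lp ℝ 2 (volume : Measure ℝ) → TemperedDist := fun b => (innerSL ℝ b).comp D
  -- Precomposition with the continuous map `D` from test functions to `L²(ℝ)` is continuous into
  -- the strong topology, so continuous paths in `L²(ℝ)` become continuous paths of distributions.
  have hΛ : Continuous Λ :=
    (ContinuousLinearMap.precomp ℝ D).continuous.comp (innerSL ℝ).continuous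
  refine ⟨fun t ω => Λ (V ω (Set.projIcc 0 T hT.le t)), fun t u => ?_, fun ω => ?_, fun t u => ?_⟩
  · have hc : Continuous fun f : C(Set.Icc (0 : ℝ) T, Lp ℝ 2 (volume : Measure ℝ)) =>
        inner ℝ (f (Set.projIcc 0 T hT.le t)) (D u) :=
      (ContinuousMap.evalCLM ℝ (Set.projIcc 0 T hT.le t)).continuous.inner continuous_const
    exact (hc.comp_stronglyMeasurable (Lp.stronglyMeasurable V)).measurable
  · exact hΛ.comp ((V ω).continuous.comp continuous_projIcc)
  · have h1 : ∫ z, inner ℝ (D u) ((1 + z ^ 2)⁻¹ • expLp z) • expLp z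
        = (SchwartzMap.derivCLM ℝ ℝ u).toLp 2 (volume : Measure ℝ) := by
      rw [← integral_smul_expLp]
      refine integral_congr_ae (ae_of_all _ fun z => ?_)
      simp only
      rw [← inner_expLp_weightedDeriv u z, real_inner_comm]
      rfl
    have h2 := hV (D u) t
    rw [h1, hL] at h2
    filter_upwards [h2] with ω hω
    rw [← hω, Set.projIcc_val]
    exact real_inner_comm (D u) (V ω t)

end DistributionProcess

/-! ### The limit as `ε → 0` and the conclusion. -/

section QuadraticField

variable {Ω : Type*} [MeasurableSpace Ω] {P : Measure Ω} [IsProbabilityMeasure P]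
  {T χ κ : ℝ} {Y : ℝ → Ω → TemperedDist}

theorem exists_tendsto_quadL2 (hT : 0 ≤ T) (hχ : 0 ≤ χ) (hκ : 0 ≤ κ) (hY : IsMeasurableProcess P T Y)
    (hS : ConditionS P T χ Y) (hE : ConditionEC2 P T κ Y) (u : 𝓢(ℝ, ℝ)) {t : ℝ}
    (ht : t ∈ Set.Icc 0 T) :
    ∃ Z : Lp ℝ 2 P, Tendsto (fun ε => quadL2 P χ Y ε 0 t u) (𝓝[>] 0) (𝓝 Z) := by
  rw [← cauchy_map_iff_exists_tendsto, Metric.cauchy_iff]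
  refine ⟨inferInstance, fun r hr => ?_⟩
  have hlim : Tendsto (fun η : ℝ => κ * (t - 0) * η * energy u) (𝓝[>] 0) (𝓝 0) := by
    have : Continuous fun η : ℝ => κ * (t - 0) * η * energy u := by fun_prop
    simpa using (this.tendsto 0).mono_left nhdsWithin_le_nhds
  obtain ⟨η, hη, hη0, hη1⟩ := ((hlim.eventually (gt_mem_nhds (pow_pos hr 2))).and
    (Ioo_mem_nhdsGT (zero_lt_one' ℝ))).exists
  have key : ∀ δ ε : ℝ, 0 < δ → δ ≤ ε → ε < η →
      dist (quadL2 P χ Y δ 0 t u) (quadL2 P χ Y ε 0 t u) < r := by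
    intro δ ε hδ hδε hε
    rw [dist_comm, dist_eq_norm]
    refine lt_of_pow_lt_pow_left₀ 2 hr.le (lt_of_le_of_lt ?_ hη)
    refine (norm_sq_quadL2_sub_le hχ hκ hY hS hE u hδ hδε (hε.trans hη1) ⟨le_rfl, hT⟩ ht
      ht.1).trans ?_
    have : 0 ≤ κ * (t - 0) := mul_nonneg hκ (by simpa using ht.1)
    have := energy_nonneg u
    gcongr
  refine ⟨_, image_mem_map (Ioo_mem_nhdsGT hη0), ?_⟩
  rintro _ ⟨δ, hδ, rfl⟩ _ ⟨ε, hε, rfl⟩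
  rcases le_total δ ε with h | h
  · exact key δ ε hδ.1 h hε.2
  · rw [dist_comm]
    exact key ε δ hε.1 h hδ.2

/-- The constant in the bound on the increments of the limit field. -/
def incrementConst (T χ κ : ℝ) : ℝ :=
  2 * κ * (2 * (1 + √T))⁻¹ + 8 * χ ^ 2 * (2 * (1 + √T))

theorem incrementConst_pos (hκ : 0 < κ) : 0 < incrementConst T χ κ := by
  unfold incrementConst
  positivity

/-- The direct bound blows up as `δ → 0`, so it is used at the coarser scale `ε`, with (EC2) paying
for the passage from `ε` to `δ`. The scale `ε` stays free for optimization. -/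
theorem norm_sq_quadL2_le_of_le (hχ : 0 ≤ χ) (hκ : 0 ≤ κ) (hY : IsMeasurableProcess P T Y)
    (hS : ConditionS P T χ Y) (hE : ConditionEC2 P T κ Y) (u : 𝓢(ℝ, ℝ)) {δ ε s t : ℝ}
    (hδ : 0 < δ) (hδε : δ ≤ ε) (hε : ε < 1) (hs : s ∈ Set.Icc 0 T) (ht : t ∈ Set.Icc 0 T)
    (hst : s ≤ t) :
    ‖quadL2 P χ Y δ s t u‖ ^ 2 ≤
      (2 * κ * (t - s) * ε + 8 * χ ^ 2 * (t - s) ^ 2 / ε) * energy u := by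
  have h1 := norm_sq_quadL2_sub_le hχ hκ hY hS hE u hδ hδε hε hs ht hst
  have h2 := norm_sq_quadL2_le hχ hS (hδ.trans_le hδε) u hs ht
  have h3 : ‖quadL2 P χ Y δ s t u‖ ≤
      ‖quadL2 P χ Y ε s t u‖ + ‖quadL2 P χ Y ε s t u - quadL2 P χ Y δ s t u‖ := by
    simpa using norm_sub_le (quadL2 P χ Y ε s t u)
      (quadL2 P χ Y ε s t u - quadL2 P χ Y δ s t u)
  calc ‖quadL2 P χ Y δ s t u‖ ^ 2
      ≤ (‖quadL2 P χ Y ε s t u‖ + ‖quadL2 P χ Y ε s t u - quadL2 P χ Y δ s t u‖) ^ 2 := by gcongr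
    _ ≤ 2 * (‖quadL2 P χ Y ε s t u‖ ^ 2 +
          ‖quadL2 P χ Y ε s t u - quadL2 P χ Y δ s t u‖ ^ 2) := add_sq_le
    _ ≤ 2 * ((t - s) ^ 2 * (4 * χ ^ 2 / ε * energy u) + κ * (t - s) * ε * energy u) := by gcongr
    _ = _ := by ring

theorem norm_sq_sub_le_of_tendsto (hT : 0 ≤ T) (hχ : 0 ≤ χ) (hκ : 0 ≤ κ)
    (hY : IsMeasurableProcess P T Y) (hS : ConditionS P T χ Y) (hE : ConditionEC2 P T κ Y)
    (u : 𝓢(ℝ, ℝ)) {s t : ℝ} (hs : s ∈ Set.Icc 0 T) (ht : t ∈ Set.Icc 0 T) (hst : s ≤ t)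
    {Z Z' : Lp ℝ 2 P} (hZ : Tendsto (fun ε => quadL2 P χ Y ε 0 s u) (𝓝[>] 0) (𝓝 Z))
    (hZ' : Tendsto (fun ε => quadL2 P χ Y ε 0 t u) (𝓝[>] 0) (𝓝 Z')) :
    ‖Z' - Z‖ ^ 2 ≤ incrementConst T χ κ * (t - s) ^ (3 / 2 : ℝ) * energy u := by
  rcases hst.eq_or_lt with rfl | hst'
  · simp [tendsto_nhds_unique hZ' hZ]
  have hh : 0 < t - s := sub_pos.2 hst'
  have hrt : 0 < √(t - s) := Real.sqrt_pos.2 hh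
  have hsq : √(t - s) * √(t - s) = t - s := Real.mul_self_sqrt hh.le
  have hle : √(t - s) ≤ √T := Real.sqrt_le_sqrt (by linarith [hs.1, ht.2])
  -- A scale proportional to `√(t - s)` gives both `(t - s) * ε` and `(t - s) ^ 2 / ε` the order `(t
  -- - s) ^ (3 / 2)`. The factor `b⁻¹` keeps it below `1`, as (EC2) requires.
  set b : ℝ := 2 * (1 + √T) with hb
  have hb0 : 0 < b := by positivity
  set ε : ℝ := b⁻¹ * √(t - s) with hεdef
  have hε0 : 0 < ε := by positivity
  have hε1 : ε < 1 := by
    rw [hεdef, inv_mul_lt_one₀ hb0]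
    linarith [Real.sqrt_nonneg T]
  have hpow : (t - s) ^ (3 / 2 : ℝ) = (t - s) * √(t - s) := by
    rw [Real.sqrt_eq_rpow, ← Real.rpow_one_add' hh.le (by norm_num)]
    norm_num
  have hlim : Tendsto (fun δ => ‖quadL2 P χ Y δ s t u‖ ^ 2) (𝓝[>] 0) (𝓝 (‖Z' - Z‖ ^ 2)) := by
    refine (((hZ'.sub hZ).norm.pow 2).congr' ?_)
    filter_upwards [self_mem_nhdsWithin] with δ hδ
    rw [← quadL2_add_adjacent hχ hY hS hδ u ⟨le_rfl, hT⟩ hs ht, add_sub_cancel_left]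
  refine le_of_tendsto hlim ?_
  filter_upwards [Ioo_mem_nhdsGT hε0] with δ hδ
  refine (norm_sq_quadL2_le_of_le hχ hκ hY hS hE u hδ.1 hδ.2.le hε1 hs ht hst).trans_eq ?_
  rw [hpow, incrementConst, ← hb, hεdef]
  congr 1
  have : (t - s) ^ 2 = (t - s) * (√(t - s) * √(t - s)) := by rw [hsq, sq]
  rw [this]
  field_simp

/-- The limit field of `A^ε_{0,t}`, as `ε` tends to zero. -/
theorem exists_limit_field (hT : 0 ≤ T) (hχ : 0 ≤ χ) (hκ : 0 ≤ κ)
    (hY : IsMeasurableProcess P T Y) (hS : ConditionS P T χ Y) (hE : ConditionEC2 P T κ Y) :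
    ∃ a : Set.Icc (0 : ℝ) T → 𝓢(ℝ, ℝ) →ₗ[ℝ] Lp ℝ 2 P, ∀ (t : Set.Icc (0 : ℝ) T) u,
      Tendsto (fun ε => quadL2 P χ Y ε 0 t u) (𝓝[>] 0) (𝓝 (a t u)) := by
  choose Z hZ using fun (t : Set.Icc (0 : ℝ) T) u =>
    exists_tendsto_quadL2 hT hχ hκ hY hS hE u t.2
  refine ⟨fun t => ⟨⟨Z t, fun u v => ?_⟩, fun c u => ?_⟩, hZ⟩
  · refine tendsto_nhds_unique (hZ t (u + v)) (((hZ t u).add (hZ t v)).congr' ?_)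
    filter_upwards [self_mem_nhdsWithin] with ε hε
    exact (quadL2_add hχ hY hS hε u v ⟨le_rfl, hT⟩ t.2).symm
  · refine tendsto_nhds_unique (hZ t (c • u)) (((hZ t u).const_smul c).congr fun ε => ?_)
    exact (quadL2_smul ε 0 t c u).symm

theorem meanSq_quadTerm_sub {X : Ω → ℝ} (hχ : 0 ≤ χ) (hY : IsMeasurableProcess P T Y)
    (hS : ConditionS P T χ Y) {ε : ℝ} (hε : 0 < ε) (u : 𝓢(ℝ, ℝ)) {s t : ℝ}
    (hs : s ∈ Set.Icc 0 T) (ht : t ∈ Set.Icc 0 T) {Z : Lp ℝ 2 P} (hX : X =ᵐ[P] Z) :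
    meanSq P (fun ω => quadTerm P Y ε s t u ω - X ω) =
      ENNReal.ofReal (‖quadL2 P χ Y ε s t u - Z‖ ^ 2) := by
  rw [← meanSq_eq]
  refine meanSq_congr ?_
  filter_upwards [quadTerm_ae_eq hχ hY hS hε u hs ht, hX,
    Lp.coeFn_sub (quadL2 P χ Y ε s t u) Z] with ω h1 h2 h3
  rw [h1, h2, h3, Pi.sub_apply]

theorem tendsto_meanSq_quadTerm_sub_iff {X : Ω → ℝ} (hT : 0 ≤ T) (hχ : 0 ≤ χ)
    (hY : IsMeasurableProcess P T Y) (hS : ConditionS P T χ Y) (u : 𝓢(ℝ, ℝ)) {t : ℝ}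
    (ht : t ∈ Set.Icc 0 T) {Z : Lp ℝ 2 P} (hX : X =ᵐ[P] Z) :
    Tendsto (fun ε : ℝ => meanSq P fun ω => quadTerm P Y ε 0 t u ω - X ω) (𝓝[>] 0) (𝓝 0) ↔
      Tendsto (fun ε => quadL2 P χ Y ε 0 t u) (𝓝[>] 0) (𝓝 Z) := by
  have h1 : (fun ε : ℝ => meanSq P fun ω => quadTerm P Y ε 0 t u ω - X ω) =ᶠ[𝓝[>] 0]
      fun ε => ENNReal.ofReal (‖quadL2 P χ Y ε 0 t u - Z‖ ^ 2) := by
    filter_upwards [self_mem_nhdsWithin] with ε hε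
    exact meanSq_quadTerm_sub hχ hY hS hε u ⟨le_rfl, hT⟩ ht hX
  rw [tendsto_congr' h1, tendsto_iff_norm_sub_tendsto_zero]
  constructor
  · intro h
    have h2 := ((ENNReal.tendsto_toReal ENNReal.zero_ne_top).comp h).sqrt
    simpa [Function.comp_def, ENNReal.toReal_ofReal (sq_nonneg _)] using h2
  · intro h
    simpa using ENNReal.tendsto_ofReal (h.pow 2)

theorem conditionNL_and_meanSq_le (hT : 0 < T) (hχ : 0 ≤ χ) (hκ : 0 < κ)
    (hY : IsMeasurableProcess P T Y) (hS : ConditionS P T χ Y) (hE : ConditionEC2 P T κ Y) :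
    ConditionNL P T Y ∧ ∀ A : ℝ → Ω → TemperedDist, IsQuadraticProcess P T Y A →
      ∀ t ∈ Set.Icc 0 T, ∀ u : 𝓢(ℝ, ℝ), meanSq P (fun ω => A t ω u) ≤
        ENNReal.ofReal (incrementConst T χ κ * t ^ (3 / 2 : ℝ) * energy u) := by
  obtain ⟨a, ha⟩ := exists_limit_field hT.le hχ hκ.le hY hS hE
  have h0 : ∀ u, a ⟨0, le_rfl, hT.le⟩ u = 0 := fun u =>
    tendsto_nhds_unique (ha ⟨0, le_rfl, hT.le⟩ u) (by simp [quadL2])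
  have hinc : ∀ u, ∀ s t : Set.Icc (0 : ℝ) T, s ≤ t → ‖a t u - a s u‖ ^ 2 ≤
      incrementConst T χ κ * ((t : ℝ) - s) ^ (3 / 2 : ℝ) * energy u := fun u s t hst =>
    norm_sq_sub_le_of_tendsto hT.le hχ hκ.le hY hS hE u s.2 t.2 hst (ha s u) (ha t u)
  constructor
  · obtain ⟨A, hA1, hA2, hA3⟩ := exists_distribution_process hT
      (Real.sqrt_nonneg (incrementConst T χ κ)) a h0 (fun u s t => by
        rw [Real.sq_sqrt (incrementConst_pos hκ).le]
        rcases le_total s t with h | h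
        · rw [abs_of_nonneg (sub_nonneg.2 (Subtype.coe_le_coe.2 h))]
          exact hinc u s t h
        · rw [norm_sub_rev, abs_sub_comm, abs_of_nonneg (sub_nonneg.2 (Subtype.coe_le_coe.2 h))]
          exact hinc u t s h)
    refine ⟨A, fun t _ => hA1 t, fun ω => (hA2 ω).continuousOn, fun t ht u => ?_,
      fun t ht u ε hε => ?_, fun t ht u => ?_⟩
    · exact (Lp.memLp (a ⟨t, ht⟩ u)).ae_eq (hA3 ⟨t, ht⟩ u).symm
    · exact (Lp.memLp (quadL2 P χ Y ε 0 t u)).ae_eq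
        (quadTerm_ae_eq hχ hY hS hε u ⟨le_rfl, hT.le⟩ ht).symm
    · exact (tendsto_meanSq_quadTerm_sub_iff hT.le hχ hY hS u ht (hA3 ⟨t, ht⟩ u)).2
        (ha ⟨t, ht⟩ u)
  -- Any admissible `A` has the same one-time values as `a`, by uniqueness of limits in `L²(P)`, so
  -- the bound holds for all of them and not only for the version just built.
  · intro A hA t ht u
    have h1 : (fun ω => A t ω u) =ᵐ[P] classL2 P fun ω => A t ω u :=
      (coeFn_classL2 (hA.memLp t ht u)).symm
    have h2 := (tendsto_meanSq_quadTerm_sub_iff hT.le hχ hY hS u ht h1).1 (hA.tendsto t ht u)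
    rw [meanSq_congr h1, tendsto_nhds_unique h2 (ha ⟨t, ht⟩ u), meanSq_eq]
    refine ENNReal.ofReal_le_ofReal ?_
    simpa [h0] using hinc u ⟨0, le_rfl, hT.le⟩ ⟨t, ht⟩ ht.1

end QuadraticField

end SBE

end

theorem theorem2 (T χ κ : ℝ) (hT : 0 < T) (hχ : 0 < χ) (hκ : 0 < κ) :
    ∃ K : ℝ, 0 < K ∧
      ∀ (Ω : Type*) [MeasurableSpace Ω] (P : Measure Ω) [IsProbabilityMeasure P]
        (Y : ℝ → Ω → SBE.TemperedDist),
        SBE.IsMeasurableProcess P T Y → SBE.ConditionS P T χ Y → SBE.ConditionEC2 P T κ Y →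
          SBE.ConditionNL P T Y ∧
          ∀ A : ℝ → Ω → SBE.TemperedDist, SBE.IsQuadraticProcess P T Y A →
            ∀ t ∈ Set.Icc 0 T, ∀ u : 𝓢(ℝ, ℝ),
              SBE.meanSq P (fun ω => A t ω u) ≤
                ENNReal.ofReal (K * t ^ (3 / 2 : ℝ) * SBE.energy u) :=
  ⟨SBE.incrementConst T χ κ, SBE.incrementConst_pos hκ, fun _ _ _ _ _ hY hS hE =>
    SBE.conditionNL_and_meanSq_le hT hχ.le hκ hY hS hE⟩
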